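/- Let $A_0,A_1$ be quasi-normed spaces (real or complex) continuously embedded in a common Hausdorff topological vector space. For $f\in A_0+A_1$ and $t>0$ let $K(t,f)=K(t,f;A_0,A_1)=\inf\{\|f_0\|_{A_0}+t\|f_1\|_{A_1}: f=f_0+f_1,\ f_j\in A_j\}$, and write $\|\cdot\|_{q,(a,b)}$ for the $L^q$-quasi-norm on $(a,b)$. For non-negative quantities, $F\approx G$ means $c^{-1}G\le F\le cG$ with a constant $c>0$ independent of the variables. A Lebesgue measurable $b:(0,\infty)\to(0,\infty)$ is slowly varying if for every $\varepsilon>0$ the function $t^{\varepsilon}b(t)$ is equivalent ($\approx$) on $(0,\infty)$ to a positive non-decreasing function and $t^{-\varepsilon}b(t)$ to a positive non-increasing one. For $0<q\le\infty$ write $b\in SV_{0,q}$ if $b$ is slowly varying and $\|u^{-1/q}b(u)\|_{q,(1,\infty)}<\infty$ (with $1/\infty=0$), and let $\bar A_{0,q;b}$ be the space of all $f\in A_0+A_1$ for which $\|f\|_{\bar A_{0,q;b}}=\|u^{-1/q}b(u)K(u,f)\|_{q,(0,\infty)}$ is finite. Let $0<q_0,q_1\le\infty$, $q_0\ne q_1$,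 and $b_j\in SV_{0,q_j}$ $(j=0,1)$. For $t>0$ and $\epsilon>0$ put $$\rho(t)=\frac{\|u^{-1/q_0}b_0(u)\|_{q_0,(t,\infty)}}{\|u^{-1/q_1}b_1(u)\|_{q_1,(t,\infty)}},\qquad \rho_\epsilon(t)=\frac{\|u^{-1/q_0}b_0(u)\|_{q_0,(t,\infty)}^{1+\epsilon}}{\|u^{-1/q_1}b_1(u)\|_{q_1,(t,\infty)}},$$ $$I(t,f)=\|u^{-1/q_0}b_0(u)K(u,f)\|_{q_0,(0,t)},\qquad J(t,f)=\|u^{-1/q_1}b_1(u)K(u,f)\|_{q_1,(t,\infty)}.$$ Consider the condition (C) for some $\epsilon>0$, $\rho_\epsilon$ is equivalent on $(0,\infty)$ to a non-decreasing function, and the formula (H) $K(\rho(t),f;\bar A_{0,q_0;b_0},\bar A_{0,q_1;b_1})\approx I(t,f)+\rho(t)J(t,f)$ for all $f\in A_0+A_1$ and all $t>0$, with constants independent of $f$ and $t$, where $K(s,f;\bar A_{0,q_0;b_0},\bar A_{0,q_1;b_1})$ is the $K$-functional of the couple of the two interpolation spaces, equal to $\infty$ if $f\notin \bar A_{0,q_0;b_0}+\bar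 A_{0,q_1;b_1}$. Then (C) implies (H). Conversely, if the couple $(A_0,A_1)$ is $K$-surjective, that is, if for every $\phi:(0,\infty)\to(0,\infty)$ such that $\phi(t)$ and $t\phi(1/t)$ are non-decreasing there is $f\in A_0+A_1$ with $\phi(t)\approx K(t,f)$ for $t>0$ (with constants that may depend on $\phi$), then (H) implies (C). -/

import Mathlib

open MeasureTheory Set Topology
open scoped NNReal ENNReal

noncomputable section

namespace Holmstedt

/-- Two-sided equivalence `F ≈ G` on `S`, with a constant independent of the points of `S`. -/
def Equivalent {ι α : Type*} [LE α] [SMul ℝ≥0 α] (S : Set ι) (F G : ι → α) : Prop :=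
  ∃ c : ℝ≥0, 0 < c ∧ ∀ i ∈ S, F i ≤ c • G i ∧ G i ≤ c • F i

/-- Slowly varying functions on `(0, ∞)`; only the values of `b` on `(0, ∞)` matter. -/
structure SlowlyVarying (b : ℝ → ℝ) : Prop where
  pos : ∀ t, 0 < t → 0 < b t
  measurable : AEMeasurable b (volume.restrict (Ioi 0))
  exists_monotone : ∀ ε : ℝ, 0 < ε → ∃ g : ℝ → ℝ, (∀ t, 0 < t → 0 < g t) ∧
    MonotoneOn g (Ioi 0) ∧ Equivalent (Ioi 0) (fun t => t ^ ε * b t) g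
  exists_antitone : ∀ ε : ℝ, 0 < ε → ∃ g : ℝ → ℝ, (∀ t, 0 < t → 0 < g t) ∧
    AntitoneOn g (Ioi 0) ∧ Equivalent (Ioi 0) (fun t => t ^ (-ε) * b t) g

/-- The weight `u ^ (-θ - 1/q) * b u`, with `1/∞ = 0`. -/
def weight (θ : ℝ) (q : ℝ≥0∞) (b : ℝ → ℝ) (u : ℝ) : ℝ≥0∞ :=
  ENNReal.ofReal (u ^ (-θ - q⁻¹.toReal) * b u)

/-- The quasi-norm `‖u ^ (-1/q) b(u)‖` in `L^q` of the interval `(t, ∞)`. -/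
def tailNorm (q : ℝ≥0∞) (b : ℝ → ℝ) (t : ℝ) : ℝ≥0∞ :=
  eLpNorm (weight 0 q b) q (volume.restrict (Ioi t))

/-- The class `SV_{0,q}`. -/
def SVZero (q : ℝ≥0∞) (b : ℝ → ℝ) : Prop :=
  SlowlyVarying b ∧ tailNorm q b 1 < ∞

/-- The function `ρ`. -/
def rho (q₀ q₁ : ℝ≥0∞) (b₀ b₁ : ℝ → ℝ) (t : ℝ) : ℝ≥0∞ :=
  tailNorm q₀ b₀ t / tailNorm q₁ b₁ t

/-- The function `ρ_ε`. -/
def rhoEps (ε : ℝ) (q₀ q₁ : ℝ≥0∞) (b₀ b₁ : ℝ → ℝ) (t : ℝ) : ℝ≥0∞ :=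
  tailNorm q₀ b₀ t ^ (1 + ε) / tailNorm q₁ b₁ t

/-- For some `ε > 0`, the function `ρ_ε` is equivalent to a non-decreasing function
on `(0, ∞)`. -/
def RhoCondition (q₀ q₁ : ℝ≥0∞) (b₀ b₁ : ℝ → ℝ) : Prop :=
  ∃ ε : ℝ, 0 < ε ∧ ∃ g : ℝ → ℝ≥0, MonotoneOn g (Ioi 0) ∧
    Equivalent (Ioi 0) (rhoEps ε q₀ q₁ b₀ b₁) (fun t => (g t : ℝ≥0∞))

/-- A quasi-normed space continuously embedded in the topological vector space `V`, given by its
image in `V` and its quasi-norm (only the values of `qnorm` on that image matter). -/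
structure QuasiNormedSubspace (𝕜 V : Type*) [RCLike 𝕜] [AddCommGroup V] [Module 𝕜 V]
    [TopologicalSpace V] where
  toSubmodule : Submodule 𝕜 V
  qnorm : V → ℝ
  nonneg : ∀ x ∈ toSubmodule, 0 ≤ qnorm x
  eq_zero : ∀ x ∈ toSubmodule, qnorm x = 0 → x = 0
  smul : ∀ (c : 𝕜), ∀ x ∈ toSubmodule, qnorm (c • x) = ‖c‖ * qnorm x
  add_le : ∃ C : ℝ, ∀ x ∈ toSubmodule, ∀ y ∈ toSubmodule,
    qnorm (x + y) ≤ C * (qnorm x + qnorm y)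
  continuous_embedding : ∀ U ∈ 𝓝 (0 : V), ∃ δ : ℝ, 0 < δ ∧
    ∀ x ∈ toSubmodule, qnorm x < δ → x ∈ U

/-- The `K`-functional of two sets `S₀`, `S₁` carrying the functionals `N₀`, `N₁`; the infimum
over the empty set of decompositions is `∞`. -/
def kFunctional {V : Type*} [Add V] (S₀ S₁ : Set V) (N₀ N₁ : V → ℝ≥0∞) (t : ℝ≥0∞) (f : V) :
    ℝ≥0∞ :=
  ⨅ (f₀ ∈ S₀) (f₁ ∈ S₁) (_ : f = f₀ + f₁), N₀ f₀ + t * N₁ f₁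

section Couple

variable {𝕜 V : Type*} [RCLike 𝕜] [AddCommGroup V] [Module 𝕜 V] [TopologicalSpace V]

/-- `K(t, f; A₀, A₁)` for a couple of quasi-normed spaces embedded in `V`. -/
def K (A₀ A₁ : QuasiNormedSubspace 𝕜 V) (t : ℝ) (f : V) : ℝ≥0∞ :=
  kFunctional (A₀.toSubmodule : Set V) (A₁.toSubmodule : Set V)
    (fun x => ENNReal.ofReal (A₀.qnorm x)) (fun x => ENNReal.ofReal (A₁.qnorm x))
    (ENNReal.ofReal t) f

/-- `‖u ^ (-θ - 1/q) b(u) K(u, f; A₀, A₁)‖` in `L^q` of the set `E`. -/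
def kNorm (A₀ A₁ : QuasiNormedSubspace 𝕜 V) (θ : ℝ) (q : ℝ≥0∞) (b : ℝ → ℝ) (E : Set ℝ)
    (f : V) : ℝ≥0∞ :=
  eLpNorm (fun u => weight θ q b u * K A₀ A₁ u f) q (volume.restrict E)

/-- The quasi-norm of the `K`-interpolation space `(A₀, A₁)_{θ,q;b}`. -/
def interpNorm (A₀ A₁ : QuasiNormedSubspace 𝕜 V) (θ : ℝ) (q : ℝ≥0∞) (b : ℝ → ℝ) (f : V) :
    ℝ≥0∞ :=
  kNorm A₀ A₁ θ q b (Ioi 0) f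

/-- The `K`-interpolation space `(A₀, A₁)_{θ,q;b}` as a subset of `A₀ + A₁`. -/
def interpSpace (A₀ A₁ : QuasiNormedSubspace 𝕜 V) (θ : ℝ) (q : ℝ≥0∞) (b : ℝ → ℝ) : Set V :=
  {f | f ∈ A₀.toSubmodule ⊔ A₁.toSubmodule ∧ interpNorm A₀ A₁ θ q b f < ∞}

/-- `K(s, f; (A₀, A₁)_{0,q₀;b₀}, (A₀, A₁)_{0,q₁;b₁})`. -/
def interpK (A₀ A₁ : QuasiNormedSubspace 𝕜 V) (q₀ q₁ : ℝ≥0∞) (b₀ b₁ : ℝ → ℝ) (s : ℝ≥0∞)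
    (f : V) : ℝ≥0∞ :=
  kFunctional (interpSpace A₀ A₁ 0 q₀ b₀) (interpSpace A₀ A₁ 0 q₁ b₁)
    (interpNorm A₀ A₁ 0 q₀ b₀) (interpNorm A₀ A₁ 0 q₁ b₁) s f

/-- The Holmstedt-type formula `K(ρ(t), f; …) ≈ I(t, f) + ρ(t) J(t, f)`, for all `f ∈ A₀ + A₁`
and `t > 0`, with constants independent of `f` and `t`. -/
def HolmstedtFormula (A₀ A₁ : QuasiNormedSubspace 𝕜 V) (q₀ q₁ : ℝ≥0∞) (b₀ b₁ : ℝ → ℝ) : Prop :=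
  Equivalent {p : V × ℝ | p.1 ∈ A₀.toSubmodule ⊔ A₁.toSubmodule ∧ 0 < p.2}
    (fun p => interpK A₀ A₁ q₀ q₁ b₀ b₁ (rho q₀ q₁ b₀ b₁ p.2) p.1)
    (fun p => kNorm A₀ A₁ 0 q₀ b₀ (Ioo 0 p.2) p.1 +
      rho q₀ q₁ b₀ b₁ p.2 * kNorm A₀ A₁ 0 q₁ b₁ (Ioi p.2) p.1)

/-- Quasi-concave functions `(0, ∞) → (0, ∞)`. -/
structure QuasiConcave (φ : ℝ → ℝ) : Prop where
  pos : ∀ t, 0 < t → 0 < φ t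
  monotone : MonotoneOn φ (Ioi 0)
  monotone_transpose : MonotoneOn (fun t => t * φ (1 / t)) (Ioi 0)

/-- `K`-surjective couples; the constants of the equivalence may depend on `φ`. -/
def KSurjective (A₀ A₁ : QuasiNormedSubspace 𝕜 V) : Prop :=
  ∀ φ : ℝ → ℝ, QuasiConcave φ → ∃ f ∈ A₀.toSubmodule ⊔ A₁.toSubmodule,
    Equivalent (Ioi 0) (fun t => ENNReal.ofReal (φ t)) (fun t => K A₀ A₁ t f)

end Couple

end Holmstedt

end

/-!
Write `T_j(t)` for `tailNorm q_j b_j t`, so that `ρ = T₀ / T₁`. The upper estimate in the formula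
needs no condition: a near-optimal decomposition of `f` for `K(t, f)` bounds the left-hand side,
because `u * T_j(u)` is almost increasing. The lower estimate amounts to two Hardy-type
inequalities between the weighted norms of `K(·, f)` for `b₀` and `b₁`. Condition (C) implies them:
for finite `q_j`, with `s = T_j(u) ^ q_j` as the variable, the weight becomes Lebesgue measure, so
that powers of `T_j` can be integrated explicitly.

Conversely, for a `K`-surjective couple the formula yields these inequalities for all quasi-concave
functions in place of `K(·, f)`, and a gliding hump makes their constants uniform. Testing with
`min 1 (u / t)` shows that `ρ` is almost increasing. Let `p < q` be the two exponents and `T` the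
tail norm that belongs to `p`. On an interval where `ρ` does not double, testing with the least
quasi-concave majorant of `1 / T` bounds the `1 / p`-th power of the logarithm of the total drop
of `T` by a multiple of one plus its `1 / q`-th power. Hence `T` can only drop by a bounded factor
before `ρ` doubles, and multiplying `ρ` by a small power of `T` leaves it almost increasing.
-/

noncomputable section

namespace Holmstedt

theorem inv_le_mul_inv_of_le_mul {a b c : ℝ≥0∞} (ha : a ≠ 0) (ha' : a ≠ ∞) (hb : b ≠ 0)
    (hb' : b ≠ ∞) (h : a ≤ c * b) : b⁻¹ ≤ c * a⁻¹ := by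
  rw [← div_eq_mul_inv, ENNReal.le_div_iff_mul_le (.inl ha) (.inl ha'), mul_comm,
    ← div_eq_mul_inv, ENNReal.div_le_iff hb hb']
  exact h

section eLpNorm

variable {α : Type*} {m : MeasurableSpace α} {μ : Measure α} {f g : α → ℝ≥0∞} {C : ℝ≥0∞}

theorem eLpNorm_le_const_mul (hC : C ≠ ∞) (q : ℝ≥0∞) (h : ∀ᵐ x ∂μ, f x ≤ C * g x) :
    eLpNorm f q μ ≤ C * eLpNorm g q μ := by
  lift C to ℝ≥0 using hC
  simpa only [ENNReal.smul_def, smul_eq_mul] using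
    eLpNorm_le_nnreal_smul_eLpNorm_of_ae_le_mul' (by simpa only [enorm_eq_self] using h) q

theorem const_mul_eLpNorm_le (hC : C ≠ ∞) (q : ℝ≥0∞) (h : ∀ᵐ x ∂μ, C * f x ≤ g x) :
    C * eLpNorm f q μ ≤ eLpNorm g q μ := by
  rcases eq_or_ne C 0 with rfl | h0
  · simp
  rw [ENNReal.mul_le_iff_le_inv h0 hC]
  refine eLpNorm_le_const_mul (ENNReal.inv_ne_top.2 h0) q ?_
  filter_upwards [h] with x hx
  rwa [← ENNReal.mul_le_iff_le_inv h0 hC]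

theorem exists_add_rpow_le {r : ℝ} (hr : 0 ≤ r) :
    ∃ C : ℝ≥0, ∀ x y : ℝ≥0∞, (x + y) ^ r ≤ C * (x ^ r + y ^ r) := by
  rcases le_total r 1 with h | h
  · exact ⟨1, fun x y => by simpa using ENNReal.rpow_add_le_add_rpow x y hr h⟩
  · refine ⟨2 ^ (r - 1), fun x y => ?_⟩
    have := ENNReal.rpow_add_le_mul_rpow_add_rpow x y h
    rwa [ENNReal.coe_rpow_of_nonneg _ (by linarith), ENNReal.coe_ofNat]

theorem exists_eLpNorm_restrict_union_le (q : ℝ≥0∞) (μ : Measure α) : ∃ C : ℝ≥0,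
    ∀ (f : α → ℝ≥0∞) (E F : Set α), eLpNorm f q (μ.restrict (E ∪ F)) ≤
      C * (eLpNorm f q (μ.restrict E) + eLpNorm f q (μ.restrict F)) := by
  rcases eq_or_ne q 0 with rfl | h0
  · exact ⟨1, fun f E F => by simp⟩
  rcases eq_or_ne q ∞ with rfl | ht
  · refine ⟨1, fun f E F => ?_⟩
    rw [ENNReal.coe_one, one_mul]
    refine eLpNormEssSup_le_of_ae_enorm_bound (ae_restrict_union_iff _ _ _ |>.2 ⟨?_, ?_⟩)
    · filter_upwards [ae_le_eLpNormEssSup (f := f) (μ := μ.restrict E)] with x hx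
        using hx.trans le_self_add
    · filter_upwards [ae_le_eLpNormEssSup (f := f) (μ := μ.restrict F)] with x hx
        using hx.trans le_add_self
  · obtain ⟨C, hC⟩ := exists_add_rpow_le (r := 1 / q.toReal) (by positivity)
    refine ⟨C, fun f E F => ?_⟩
    simp only [eLpNorm_eq_lintegral_rpow_enorm_toReal h0 ht]
    refine le_trans ?_ (hC _ _)
    gcongr
    exact lintegral_union_le _ _ _

end eLpNorm

section AlmostMonotone

/-- Functions that are non-decreasing on `S` up to a multiplicative constant. For a finite
`ℝ≥0∞`-valued function this is the same as being equivalent to a non-decreasing function. -/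
def AlmostMonotoneOn {ι α : Type*} [LE ι] [LE α] [SMul ℝ≥0 α] (F : ι → α) (S : Set ι) : Prop :=
  ∃ M : ℝ≥0, ∀ s ∈ S, ∀ t ∈ S, s ≤ t → F s ≤ M • F t

variable {ι : Type*} {S : Set ι}

theorem Equivalent.of_le {F G : ι → ℝ≥0∞} {c₁ c₂ : ℝ≥0} (h₁ : ∀ i ∈ S, F i ≤ c₁ * G i)
    (h₂ : ∀ i ∈ S, G i ≤ c₂ * F i) : Equivalent S F G := by
  refine ⟨1 + c₁ + c₂, by positivity, fun i hi => ?_⟩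
  simp only [ENNReal.smul_def, smul_eq_mul]
  exact ⟨(h₁ i hi).trans (by gcongr; exact le_add_self.trans le_self_add),
    (h₂ i hi).trans (by gcongr; exact le_add_self)⟩

variable [Preorder ι]

theorem AlmostMonotoneOn.of_equivalent {α : Type*} [Preorder α] [MulAction ℝ≥0 α]
    [PosSMulMono ℝ≥0 α] {F g : ι → α} (hg : MonotoneOn g S) (h : Equivalent S F g) :
    AlmostMonotoneOn F S := by
  obtain ⟨c, -, h⟩ := h
  refine ⟨c * c, fun s hs t ht hst => ?_⟩
  rw [mul_smul]
  exact (h s hs).1.trans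
    (smul_le_smul_of_nonneg_left ((hg hs ht hst).trans (h t ht).2) c.2)

theorem AlmostMonotoneOn.exists_monotoneOn_equivalent {F : ι → ℝ≥0∞} (h : AlmostMonotoneOn F S)
    (hF : ∀ i ∈ S, F i ≠ ∞) : ∃ g : ι → ℝ≥0, MonotoneOn g S ∧
      Equivalent S F (fun i => (g i : ℝ≥0∞)) := by
  obtain ⟨M, hM⟩ := h
  simp only [ENNReal.smul_def, smul_eq_mul] at hM
  set G : ι → ℝ≥0∞ := fun t => ⨆ s ∈ S ∩ Iic t, F s
  have hGF : ∀ t ∈ S, G t ≤ M * F t := fun t ht => iSup₂_le fun s hs => hM s hs.1 t ht hs.2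
  have hFG : ∀ t ∈ S, F t ≤ G t := fun t ht => le_iSup₂_of_le t ⟨ht, le_rfl⟩ le_rfl
  have hG : ∀ t ∈ S, G t ≠ ∞ := fun t ht =>
    ne_top_of_le_ne_top (ENNReal.mul_ne_top ENNReal.coe_ne_top (hF t ht)) (hGF t ht)
  refine ⟨fun t => (G t).toNNReal, fun s _ t ht hst => ?_, .of_le (c₁ := 1) (c₂ := M) ?_ ?_⟩
  · exact ENNReal.toNNReal_mono (hG t ht)
      (biSup_mono fun _ hi => ⟨hi.1, hi.2.trans hst⟩)
  · intro t ht
    simpa only [ENNReal.coe_toNNReal (hG t ht), ENNReal.coe_one, one_mul] using hFG t ht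
  · intro t ht
    simpa only [ENNReal.coe_toNNReal (hG t ht)] using hGF t ht

theorem AlmostMonotoneOn.congr {F G : ι → ℝ≥0∞} (h : AlmostMonotoneOn F S) (hFG : EqOn F G S) :
    AlmostMonotoneOn G S := by
  obtain ⟨M, hM⟩ := h
  refine ⟨M, fun s hs t ht hst => ?_⟩
  rw [← hFG hs, ← hFG ht]
  exact hM s hs t ht hst

theorem AlmostMonotoneOn.exists_le_mul_of_le_two_mul {F : ι → ℝ≥0∞} (h : AlmostMonotoneOn F S)
    (hS : S.OrdConnected) : ∃ A : ℝ≥0, ∀ s ∈ S, ∀ t ∈ S, F t ≤ 2 * F s →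
      ∀ u ∈ Icc s t, ∀ u' ∈ Icc s t, F u ≤ A * F u' := by
  obtain ⟨M, hM⟩ := h
  simp only [ENNReal.smul_def, smul_eq_mul] at hM
  refine ⟨M * (2 * M), fun s hs t ht hst u hu u' hu' => ?_⟩
  calc F u ≤ M * F t := hM u (hS.out hs ht hu) t ht hu.2
    _ ≤ M * (2 * F s) := by gcongr
    _ ≤ M * (2 * (M * F u')) := by gcongr; exact hM s hs u' (hS.out hs ht hu') hu'.1
    _ = (M * (2 * M) : ℝ≥0) * F u' := by push_cast; ring

theorem AlmostMonotoneOn.rpow {F : ι → ℝ≥0∞} (h : AlmostMonotoneOn F S) {p : ℝ} (hp : 0 ≤ p) :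
    AlmostMonotoneOn (fun i => F i ^ p) S := by
  obtain ⟨M, hM⟩ := h
  refine ⟨M ^ p, fun s hs t ht hst => ?_⟩
  simpa only [ENNReal.smul_def, smul_eq_mul, ENNReal.mul_rpow_of_nonneg _ _ hp,
    ENNReal.coe_rpow_of_nonneg _ hp] using ENNReal.rpow_le_rpow (hM s hs t ht hst) hp

end AlmostMonotone

section weightedNorm

/-- The quasi-norm `‖u ^ (-1/q) b(u) φ(u)‖` in `L^q` of the set `E`, common to `tailNorm`, `kNorm`
and `interpNorm`. -/
def weightedNorm (q : ℝ≥0∞) (b : ℝ → ℝ) (E : Set ℝ) (φ : ℝ → ℝ≥0∞) : ℝ≥0∞ :=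
  eLpNorm (fun u => weight 0 q b u * φ u) q (volume.restrict E)

variable {q : ℝ≥0∞} {b : ℝ → ℝ} {E F : Set ℝ} {φ ψ : ℝ → ℝ≥0∞} {C : ℝ≥0∞}

theorem weightedNorm_le_mul (hC : C ≠ ∞) (hE : MeasurableSet E) (h : ∀ u ∈ E, φ u ≤ C * ψ u) :
    weightedNorm q b E φ ≤ C * weightedNorm q b E ψ := by
  refine eLpNorm_le_const_mul hC q ?_
  filter_upwards [ae_restrict_mem hE] with u hu
  rw [mul_left_comm]
  gcongr
  exact h u hu

theorem mul_weightedNorm_le (hC : C ≠ ∞) (hE : MeasurableSet E) (h : ∀ u ∈ E, C * ψ u ≤ φ u) :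
    C * weightedNorm q b E ψ ≤ weightedNorm q b E φ := by
  refine const_mul_eLpNorm_le hC q ?_
  filter_upwards [ae_restrict_mem hE] with u hu
  rw [mul_left_comm]
  gcongr
  exact h u hu

theorem weightedNorm_mono_set (h : E ⊆ F) (φ : ℝ → ℝ≥0∞) :
    weightedNorm q b E φ ≤ weightedNorm q b F φ :=
  eLpNorm_mono_measure _ (Measure.restrict_mono h le_rfl)

theorem weightedNorm_Ioi_one (t : ℝ) : weightedNorm q b (Ioi t) 1 = tailNorm q b t := by
  simp only [weightedNorm, Pi.one_apply, mul_one, tailNorm]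

theorem weightedNorm_Ioo_eq_Ioc (s t : ℝ) :
    weightedNorm q b (Ioo s t) φ = weightedNorm q b (Ioc s t) φ := by
  rw [weightedNorm, weightedNorm, Measure.restrict_congr_set Ioo_ae_eq_Ioc]

theorem weightedNorm_const_Ioi_le (hC : C ≠ ∞) {t : ℝ} (h : ∀ u ∈ Ioi t, φ u ≤ C) :
    weightedNorm q b (Ioi t) φ ≤ C * tailNorm q b t := by
  rw [← weightedNorm_Ioi_one]
  exact weightedNorm_le_mul hC measurableSet_Ioi fun u hu => by simpa using h u hu

theorem const_mul_tailNorm_le (hC : C ≠ ∞) {t : ℝ} (h : ∀ u ∈ Ioi t, C ≤ φ u) :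
    C * tailNorm q b t ≤ weightedNorm q b (Ioi t) φ := by
  rw [← weightedNorm_Ioi_one]
  exact mul_weightedNorm_le hC measurableSet_Ioi fun u hu => by simpa using h u hu

theorem exists_weightedNorm_union_le (q : ℝ≥0∞) (b : ℝ → ℝ) : ∃ C : ℝ≥0, ∀ (E F : Set ℝ)
    (φ : ℝ → ℝ≥0∞), weightedNorm q b (E ∪ F) φ ≤
      C * (weightedNorm q b E φ + weightedNorm q b F φ) := by
  obtain ⟨C, hC⟩ := exists_eLpNorm_restrict_union_le q (volume : Measure ℝ)
  exact ⟨C, fun E F φ => hC _ E F⟩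

end weightedNorm

section SlowlyVarying

variable {q : ℝ≥0∞} {b : ℝ → ℝ}

theorem SlowlyVarying.almostMonotoneOn_rpow_mul (hb : SlowlyVarying b) {ε : ℝ} (hε : 0 < ε) :
    AlmostMonotoneOn (fun t => t ^ ε * b t) (Ioi 0) :=
  let ⟨_, _, hg, h⟩ := hb.exists_monotone ε hε
  .of_equivalent hg h

theorem weight_zero_eq (q : ℝ≥0∞) (b : ℝ → ℝ) (u : ℝ) :
    weight 0 q b u = ENNReal.ofReal (u ^ (-q⁻¹.toReal) * b u) := by
  rw [weight, neg_zero, zero_sub]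

theorem SlowlyVarying.aemeasurable_weight (hb : SlowlyVarying b) {E : Set ℝ} (hE : E ⊆ Ioi 0) :
    AEMeasurable (weight 0 q b) (volume.restrict E) := by
  have h : AEMeasurable (weight 0 q b) (volume.restrict (Ioi 0)) :=
    ((measurable_id.pow_const _).aemeasurable.mul hb.measurable).ennreal_ofReal
  exact h.mono_measure (Measure.restrict_mono hE le_rfl)

theorem exists_weightedNorm_add_le (q : ℝ≥0∞) (hb : SlowlyVarying b) : ∃ C : ℝ≥0,
    ∀ (E : Set ℝ) (φ ψ : ℝ → ℝ≥0∞), E ⊆ Ioi 0 → Measurable φ → Measurable ψ →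
      weightedNorm q b E (φ + ψ) ≤ C * (weightedNorm q b E φ + weightedNorm q b E ψ) := by
  refine ⟨q.LpAddConst.toNNReal, fun E φ ψ hE hφ hψ => ?_⟩
  have hw := hb.aemeasurable_weight (q := q) hE
  rw [ENNReal.coe_toNNReal (ENNReal.LpAddConst_lt_top q).ne]
  have h := eLpNorm_add_le' (hw.mul hφ.aemeasurable).aestronglyMeasurable
    (hw.mul hψ.aemeasurable).aestronglyMeasurable q
  rwa [← mul_add] at h

theorem lintegral_Ioc_zero_rpow_sub_one {c p : ℝ} (hc : 0 < c) (hp : 0 < p) :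
    ∫⁻ s in Ioc 0 c, ENNReal.ofReal (s ^ (p - 1)) = ENNReal.ofReal (c ^ p / p) := by
  have hint : IntegrableOn (fun s : ℝ => s ^ (p - 1)) (Ioc 0 c) := by
    rw [← intervalIntegrable_iff_integrableOn_Ioc_of_le hc.le]
    exact intervalIntegral.intervalIntegrable_rpow' (by linarith)
  have hnonneg : ∀ᵐ s ∂volume.restrict (Ioc 0 c), 0 ≤ s ^ (p - 1) := by
    filter_upwards [ae_restrict_mem measurableSet_Ioc] with s hs using Real.rpow_nonneg hs.1.le _
  rw [← ofReal_integral_eq_lintegral_ofReal hint hnonneg, ← intervalIntegral.integral_of_le hc.le,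
    integral_rpow (Or.inl (by linarith)), sub_add_cancel, Real.zero_rpow hp.ne', sub_zero]

theorem exists_eLpNorm_rpow_sub_inv_le (hq : q ≠ 0) {ε : ℝ} (hε : 0 < ε) : ∃ C : ℝ≥0, ∀ s : ℝ,
    0 < s → eLpNorm (fun u : ℝ => ENNReal.ofReal (u ^ (ε - q⁻¹.toReal))) q
      (volume.restrict (Ioc 0 s)) ≤ C * ENNReal.ofReal (s ^ ε) := by
  rcases eq_or_ne q ∞ with rfl | ht
  · refine ⟨1, fun s _ => ?_⟩
    rw [eLpNorm_exponent_top, ENNReal.coe_one, one_mul]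
    refine eLpNormEssSup_le_of_ae_enorm_bound ?_
    filter_upwards [ae_restrict_mem measurableSet_Ioc] with u hu
    rw [enorm_eq_self, ENNReal.inv_top, ENNReal.toReal_zero, sub_zero]
    exact ENNReal.ofReal_le_ofReal (Real.rpow_le_rpow hu.1.le hu.2 hε.le)
  · have hr : 0 < q.toReal := ENNReal.toReal_pos hq ht
    refine ⟨(1 / (ε * q.toReal)).toNNReal ^ (1 / q.toReal), fun s hs => le_of_eq ?_⟩
    have hpow : ∀ u ∈ Ioc 0 s, ‖ENNReal.ofReal (u ^ (ε - q⁻¹.toReal))‖ₑ ^ q.toReal =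
        ENNReal.ofReal (u ^ (ε * q.toReal - 1)) := fun u hu => by
      rw [enorm_eq_self, ENNReal.ofReal_rpow_of_nonneg (Real.rpow_nonneg hu.1.le _) hr.le,
        ← Real.rpow_mul hu.1.le, ENNReal.toReal_inv, sub_mul, inv_mul_cancel₀ hr.ne']
    rw [eLpNorm_eq_lintegral_rpow_enorm_toReal hq ht,
      setLIntegral_congr_fun measurableSet_Ioc hpow,
      lintegral_Ioc_zero_rpow_sub_one hs (by positivity), div_eq_mul_one_div, mul_comm,
      ENNReal.ofReal_mul (by positivity), ENNReal.mul_rpow_of_nonneg _ _ (by positivity),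
      ENNReal.coe_rpow_of_nonneg _ (by positivity), ENNReal.ofReal_rpow_of_pos (x := s ^ _)
      (by positivity), ← Real.rpow_mul hs.le, mul_assoc, mul_one_div_cancel hr.ne', mul_one]
    rfl

theorem SlowlyVarying.exists_weightedNorm_id_le (hb : SlowlyVarying b) (hq : q ≠ 0) :
    ∃ C : ℝ≥0, ∀ s : ℝ, 0 < s →
      weightedNorm q b (Ioc 0 s) ENNReal.ofReal ≤
        C * (ENNReal.ofReal s * ENNReal.ofReal (b s)) := by
  have hsqrt : ∀ u : ℝ, 0 < u → u ^ (1 / 2 : ℝ) * u ^ (1 / 2 : ℝ) = u := fun u hu => by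
    rw [← Real.rpow_add hu, add_halves, Real.rpow_one]
  obtain ⟨A, hA⟩ := hb.almostMonotoneOn_rpow_mul (ε := 1 / 2) (by norm_num)
  obtain ⟨C, hC⟩ := exists_eLpNorm_rpow_sub_inv_le hq (ε := 1 / 2) (by norm_num)
  refine ⟨A * C, fun s hs => ?_⟩
  have : 0 < b s := hb.pos s hs
  calc weightedNorm q b (Ioc 0 s) ENNReal.ofReal
      ≤ A * ENNReal.ofReal (s ^ (1 / 2 : ℝ) * b s) *
        eLpNorm (fun u : ℝ => ENNReal.ofReal (u ^ (1 / 2 - q⁻¹.toReal))) q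
          (volume.restrict (Ioc 0 s)) := by
        refine eLpNorm_le_const_mul (by finiteness) q ?_
        filter_upwards [ae_restrict_mem measurableSet_Ioc] with u hu
        have hbu := hb.pos u hu.1
        have hu0 := hu.1
        have hsplit : u ^ (-q⁻¹.toReal) * b u * u =
            u ^ (1 / 2 : ℝ) * b u * u ^ (1 / 2 - q⁻¹.toReal) := by
          rw [sub_eq_add_neg (1 / 2 : ℝ), Real.rpow_add hu0]
          linear_combination -(u ^ (-q⁻¹.toReal) * b u) * hsqrt u hu0
        have hmono := hA u hu0 s hs hu.2
        rw [NNReal.smul_def, smul_eq_mul] at hmono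
        rw [weight_zero_eq, ← ENNReal.ofReal_mul (by positivity), hsplit,
          ENNReal.ofReal_mul (by positivity), ← ENNReal.ofReal_coe_nnreal (p := A),
          ← ENNReal.ofReal_mul A.coe_nonneg]
        gcongr
    _ ≤ A * ENNReal.ofReal (s ^ (1 / 2 : ℝ) * b s) * (C * ENNReal.ofReal (s ^ (1 / 2 : ℝ))) := by
        gcongr; exact hC s hs
    _ = (A * C : ℝ≥0) * (ENNReal.ofReal (s ^ (1 / 2 : ℝ) * s ^ (1 / 2 : ℝ)) *
          ENNReal.ofReal (b s)) := by
        rw [ENNReal.ofReal_mul (by positivity), ENNReal.ofReal_mul (by positivity)]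
        push_cast
        ring
    _ = _ := by rw [hsqrt s hs]

theorem SlowlyVarying.exists_le_weight_Ioo (hb : SlowlyVarying b) (q : ℝ≥0∞) : ∃ C : ℝ≥0,
    ∀ u v : ℝ, 0 < u → v ∈ Ioo u (2 * u) →
      ENNReal.ofReal (u ^ (-q⁻¹.toReal) * b u) ≤ C * weight 0 q b v := by
  obtain ⟨A, hA⟩ := hb.almostMonotoneOn_rpow_mul (ε := 1) one_pos
  refine ⟨2 ^ q⁻¹.toReal * (2 * A), fun u v hu hv => ?_⟩
  have hv0 : 0 < v := hu.trans hv.1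
  have hbv := hb.pos v hv0
  have hbu : b u ≤ 2 * A * b v := by
    have hmono := hA u hu v hv0 hv.1.le
    simp only [Real.rpow_one, NNReal.smul_def, smul_eq_mul] at hmono
    refine le_of_mul_le_mul_left (hmono.trans ?_) hu
    calc A * (v * b v) ≤ A * (2 * u * b v) := by gcongr; exact hv.2.le
      _ = u * (2 * A * b v) := by ring
  have hpow : u ^ (-q⁻¹.toReal) ≤ 2 ^ q⁻¹.toReal * v ^ (-q⁻¹.toReal) := by
    calc u ^ (-q⁻¹.toReal) = 2 ^ q⁻¹.toReal * (2 * u) ^ (-q⁻¹.toReal) := by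
          rw [Real.mul_rpow zero_le_two hu.le, ← mul_assoc, ← Real.rpow_add two_pos,
            add_neg_cancel, Real.rpow_zero, one_mul]
      _ ≤ _ := by
          exact mul_le_mul_of_nonneg_left (Real.rpow_le_rpow_of_nonpos hv0 hv.2.le
            (neg_nonpos.2 ENNReal.toReal_nonneg)) (by positivity)
  rw [weight_zero_eq, ← ENNReal.ofReal_coe_nnreal, ← ENNReal.ofReal_mul NNReal.zero_le_coe]
  refine ENNReal.ofReal_le_ofReal ?_
  calc u ^ (-q⁻¹.toReal) * b u
      ≤ (2 ^ q⁻¹.toReal * v ^ (-q⁻¹.toReal)) * (2 * A * b v) :=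
        mul_le_mul hpow hbu (hb.pos u hu).le (by positivity)
    _ = _ := by push_cast; ring

theorem SlowlyVarying.exists_le_tailNorm (hb : SlowlyVarying b) (hq : q ≠ 0) :
    ∃ C : ℝ≥0, ∀ u : ℝ, 0 < u → ENNReal.ofReal (b u) ≤ C * tailNorm q b u := by
  obtain ⟨C, hC⟩ := hb.exists_le_weight_Ioo q
  refine ⟨C, fun u hu => ?_⟩
  have hμ : volume.restrict (Ioo u (2 * u)) ≠ 0 := by
    rw [Ne, Measure.restrict_eq_zero, Real.volume_Ioo, ENNReal.ofReal_eq_zero]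
    linarith
  calc ENNReal.ofReal (b u)
      = eLpNorm (fun _ : ℝ => ENNReal.ofReal (u ^ (-q⁻¹.toReal) * b u)) q
          (volume.restrict (Ioo u (2 * u))) := by
        rw [eLpNorm_const _ hq hμ, Measure.restrict_apply_univ, Real.volume_Ioo, enorm_eq_self,
          two_mul, add_sub_cancel_right, ENNReal.ofReal_rpow_of_pos hu, one_div,
          ← ENNReal.toReal_inv, ← ENNReal.ofReal_mul' (by positivity), mul_right_comm,
          ← Real.rpow_add hu, neg_add_cancel, Real.rpow_zero, one_mul]
    _ ≤ C * eLpNorm (weight 0 q b) q (volume.restrict (Ioo u (2 * u))) := by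
        refine eLpNorm_le_const_mul ENNReal.coe_ne_top q ?_
        filter_upwards [ae_restrict_mem measurableSet_Ioo] with v hv using hC u v hu hv
    _ ≤ C * tailNorm q b u := by
        gcongr
        exact eLpNorm_mono_measure _ (Measure.restrict_mono Ioo_subset_Ioi_self le_rfl)

theorem tailNorm_antitone : Antitone (tailNorm q b) := fun _ _ h =>
  eLpNorm_mono_measure _ (Measure.restrict_mono (Ioi_subset_Ioi h) le_rfl)

theorem SlowlyVarying.tailNorm_ne_zero (hb : SlowlyVarying b) (hq : q ≠ 0) {t : ℝ} (ht : 0 < t) :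
    tailNorm q b t ≠ 0 := by
  obtain ⟨C, hC⟩ := hb.exists_le_tailNorm hq
  intro h0
  have h := hC t ht
  rw [h0, mul_zero, nonpos_iff_eq_zero, ENNReal.ofReal_eq_zero] at h
  exact h.not_gt (hb.pos t ht)

theorem SlowlyVarying.exists_weightedNorm_id_le_tailNorm (hb : SlowlyVarying b) (hq : q ≠ 0) :
    ∃ C : ℝ≥0, ∀ s : ℝ, 0 < s →
      weightedNorm q b (Ioc 0 s) ENNReal.ofReal ≤ C * (ENNReal.ofReal s * tailNorm q b s) := by
  obtain ⟨C, hC⟩ := hb.exists_weightedNorm_id_le hq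
  obtain ⟨D, hD⟩ := hb.exists_le_tailNorm hq
  refine ⟨C * D, fun s hs => (hC s hs).trans ?_⟩
  calc (C : ℝ≥0∞) * (ENNReal.ofReal s * ENNReal.ofReal (b s))
      ≤ C * (ENNReal.ofReal s * (D * tailNorm q b s)) := by gcongr; exact hD s hs
    _ = _ := by push_cast; ring

theorem SlowlyVarying.almostMonotoneOn_mul_tailNorm (hb : SlowlyVarying b) (hq : q ≠ 0) :
    AlmostMonotoneOn (fun u => ENNReal.ofReal u * tailNorm q b u) (Ioi 0) := by
  obtain ⟨C, hC⟩ := hb.exists_weightedNorm_id_le_tailNorm hq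
  obtain ⟨D, hD⟩ := exists_weightedNorm_union_le q b
  refine ⟨D * (C + 1), fun s hs u hu hsu => ?_⟩
  rw [mem_Ioi] at hs hu
  have hnear : ENNReal.ofReal s * weightedNorm q b (Ioc s u) 1 ≤
      C * (ENNReal.ofReal u * tailNorm q b u) := by
    calc ENNReal.ofReal s * weightedNorm q b (Ioc s u) 1
        ≤ weightedNorm q b (Ioc s u) ENNReal.ofReal := by
          refine mul_weightedNorm_le ENNReal.ofReal_ne_top measurableSet_Ioc fun v hv => ?_
          rw [Pi.one_apply, mul_one]
          exact ENNReal.ofReal_le_ofReal hv.1.le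
      _ ≤ _ := (weightedNorm_mono_set (Ioc_subset_Ioc_left hs.le) _).trans (hC u hu)
  calc ENNReal.ofReal s * tailNorm q b s
      ≤ ENNReal.ofReal s * (D * (weightedNorm q b (Ioc s u) 1 + tailNorm q b u)) := by
        rw [← weightedNorm_Ioi_one s, ← weightedNorm_Ioi_one u, ← Ioc_union_Ioi_eq_Ioi hsu]
        gcongr
        exact hD _ _ _
    _ = D * (ENNReal.ofReal s * weightedNorm q b (Ioc s u) 1 +
          ENNReal.ofReal s * tailNorm q b u) := by ring
    _ ≤ D * (C * (ENNReal.ofReal u * tailNorm q b u) + ENNReal.ofReal u * tailNorm q b u) := by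
        gcongr
    _ = _ := by rw [ENNReal.smul_def, smul_eq_mul]; push_cast; ring

theorem SVZero.tailNorm_ne_top (hb : SVZero q b) (hq : q ≠ 0) {t : ℝ} (ht : 0 < t) :
    tailNorm q b t ≠ ∞ := by
  rcases le_total 1 t with h | h
  · exact ((tailNorm_antitone h).trans_lt hb.2).ne
  · obtain ⟨C, hC⟩ := hb.1.almostMonotoneOn_mul_tailNorm hq
    have hfin : ENNReal.ofReal t * tailNorm q b t ≠ ∞ := by
      refine ne_top_of_le_ne_top ?_ (hC t ht 1 (mem_Ioi.2 one_pos) h)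
      rw [ENNReal.smul_def, smul_eq_mul]
      exact ENNReal.mul_ne_top ENNReal.coe_ne_top
        (ENNReal.mul_ne_top ENNReal.ofReal_ne_top hb.2.ne)
    intro htop
    rw [htop, ENNReal.mul_top (by simpa using ht)] at hfin
    exact hfin rfl

end SlowlyVarying

section TailMeasure

theorem measurable_measureReal_Ioi (ν : Measure ℝ) : Measurable (fun u => ν.real (Ioi u)) :=
  have h : Antitone (fun u => ν (Ioi u)) := fun _ _ h => measure_mono (Ioi_subset_Ioi h)
  h.measurable.ennreal_toReal

theorem continuousOn_measureReal_Ioi {ν : Measure ℝ} [NullSingletonClass ν] {a : ℝ}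
    (ha : ν (Ioi a) ≠ ∞) : ContinuousOn (fun u => ν.real (Ioi u)) (Ici a) := by
  have hint : IntegrableOn (fun _ : ℝ => (1 : ℝ)) (Ioi a) ν := integrableOn_const ha
  simpa only [setIntegral_const, smul_eq_mul, mul_one] using hint.continuousOn_Ici_primitive_Ioi

variable {ν : Measure ℝ} [NullSingletonClass ν]

theorem exists_measureReal_Ioi_eq [IsFiniteMeasure ν] {s : ℝ} (h0 : 0 < s)
    (hs : s < ν.real univ) : ∃ x, ν.real (Ioi x) = s := by
  have hcont : Continuous (fun u => ν.real (Ioi u)) := continuous_iff_continuousAt.2 fun x =>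
    (continuousOn_measureReal_Ioi (measure_ne_top ν (Ioi (x - 1)))).continuousAt
      (Ici_mem_nhds (by linarith))
  have hzero : Filter.Tendsto (fun u => ν.real (Ioi u)) Filter.atTop (𝓝 0) := by
    simpa only [setIntegral_const, smul_eq_mul, mul_one, id_eq] using
      tendsto_integral_Ioi_zero (f := fun _ : ℝ => (1 : ℝ)) (μ := ν) (Filter.tendsto_id (α := ℝ))
  have htotal : Filter.Tendsto (fun u => ν.real (Ioi u)) Filter.atBot (𝓝 (ν.real univ)) := by
    have h := (ENNReal.tendsto_toReal (measure_ne_top ν univ)).comp (tendsto_measure_Ici_atBot ν)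
    refine h.congr fun u => ?_
    rw [Function.comp_apply, ← measureReal_def, measureReal_congr Ioi_ae_eq_Ici]
  obtain ⟨x, hx⟩ := (hzero.eventually_le_const h0).exists
  obtain ⟨y, hy⟩ := (htotal.eventually_const_le hs).exists
  exact mem_range_of_exists_le_of_exists_ge hcont ⟨x, hx⟩ ⟨y, hy⟩

theorem measureReal_setOf_measureReal_Ioi_le [IsFiniteMeasure ν] {s : ℝ} (h0 : 0 ≤ s)
    (hs : s ≤ ν.real univ) : ν.real {u | ν.real (Ioi u) ≤ s} = s := by
  have hanti : ∀ x y, x ≤ y → ν.real (Ioi y) ≤ ν.real (Ioi x) := fun x y hxy =>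
    measureReal_mono (Ioi_subset_Ioi hxy)
  apply le_antisymm
  · refine le_of_forall_gt_imp_ge_of_dense fun s' hs' => ?_
    rcases le_or_gt (ν.real univ) s' with h | h
    · exact (measureReal_mono (subset_univ _)).trans h
    · obtain ⟨x, rfl⟩ := exists_measureReal_Ioi_eq (h0.trans_lt hs') h
      refine measureReal_mono fun u (hu : ν.real (Ioi u) ≤ s) => ?_
      by_contra hux
      exact (hs'.trans_le (hanti u x (not_lt.1 hux))).not_ge hu
  · rcases h0.eq_or_lt with rfl | h0
    · exact measureReal_nonneg
    rcases hs.eq_or_lt with rfl | hs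
    · exact measureReal_mono fun u _ => measureReal_mono (subset_univ _)
    · obtain ⟨x, rfl⟩ := exists_measureReal_Ioi_eq h0 hs
      exact measureReal_mono fun u hu => hanti x u (le_of_lt hu)

theorem map_measureReal_Ioi (ν : Measure ℝ) [NullSingletonClass ν] [IsFiniteMeasure ν] :
    ν.map (fun u => ν.real (Ioi u)) = volume.restrict (Ioc 0 (ν.real univ)) := by
  have hm := measurable_measureReal_Ioi ν
  refine Measure.ext_of_Iic _ _ fun s => ?_
  rw [Measure.map_apply hm measurableSet_Iic, Measure.restrict_apply measurableSet_Iic, inter_comm,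
    Ioc_inter_Iic, Real.volume_Ioc, sub_zero]
  change ν {u | ν.real (Ioi u) ≤ s} = _
  rcases lt_or_ge s 0 with h0 | h0
  · have hempty : {u | ν.real (Ioi u) ≤ s} = ∅ :=
      eq_empty_of_forall_notMem fun u hu => (h0.trans_le measureReal_nonneg).not_ge hu
    rw [hempty, measure_empty, ENNReal.ofReal_of_nonpos ((min_le_right _ _).trans h0.le)]
  rcases le_total s (ν.real univ) with hs | hs
  · rw [min_eq_right hs, ← ofReal_measureReal, measureReal_setOf_measureReal_Ioi_le h0 hs]
  · rw [min_eq_left hs, ofReal_measureReal]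
    exact congrArg ν (eq_univ_of_forall fun u => (measureReal_mono (subset_univ _)).trans hs)

theorem setLIntegral_Ioi_comp_measureReal_Ioi {a : ℝ} (ha : ν (Ioi a) ≠ ∞) {g : ℝ → ℝ≥0∞}
    (hg : Measurable g) :
    ∫⁻ u in Ioi a, g (ν.real (Ioi u)) ∂ν = ∫⁻ s in Ioc 0 (ν.real (Ioi a)), g s := by
  have : IsFiniteMeasure (ν.restrict (Ioi a)) := ⟨by simpa using ha.lt_top⟩
  have hmap := map_measureReal_Ioi (ν.restrict (Ioi a))
  rw [measureReal_restrict_apply MeasurableSet.univ, univ_inter] at hmap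
  rw [← hmap, lintegral_map hg (measurable_measureReal_Ioi _)]
  refine setLIntegral_congr_fun measurableSet_Ioi fun u hu => ?_
  rw [measureReal_restrict_apply measurableSet_Ioi,
    inter_eq_left.2 (Ioi_subset_Ioi (le_of_lt (mem_Ioi.1 hu)))]

theorem setLIntegral_Ioc_comp_measureReal_Ioi {a t : ℝ} (ha : ν (Ioi a) ≠ ∞) (hat : a ≤ t)
    {g : ℝ → ℝ≥0∞} (hg : Measurable g) :
    ∫⁻ u in Ioc a t, g (ν.real (Ioi u)) ∂ν =
      ∫⁻ s in Ioc (ν.real (Ioi t)) (ν.real (Ioi a)), g s := by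
  have hsplit : ∀ u ∈ Icc a t, ν.real (Ioi u) = ν.real (Ioc u t) + ν.real (Ioi t) := by
    intro u hu
    have hu' : ν (Ioi u) ≠ ∞ := measure_ne_top_of_subset (Ioi_subset_Ioi hu.1) ha
    rw [← Ioc_union_Ioi_eq_Ioi hu.2, measureReal_union
      (Ioc_disjoint_Ioi le_rfl) measurableSet_Ioi
      (measure_ne_top_of_subset Ioc_subset_Ioi_self hu')
      (measure_ne_top_of_subset (Ioi_subset_Ioi hu.2) hu')]
  have : IsFiniteMeasure (ν.restrict (Ioc a t)) :=
    ⟨by simpa using (measure_ne_top_of_subset Ioc_subset_Ioi_self ha).lt_top⟩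
  have hmap := map_measureReal_Ioi (ν.restrict (Ioc a t))
  rw [measureReal_restrict_apply MeasurableSet.univ, univ_inter] at hmap
  have hshift : (fun s => s + ν.real (Ioi t)) ⁻¹' Ioc (ν.real (Ioi t)) (ν.real (Ioi a)) =
      Ioc 0 (ν.real (Ioc a t)) := by
    rw [hsplit a ⟨le_rfl, hat⟩, preimage_add_const_Ioc, sub_self, add_sub_cancel_right]
  rw [← (measurePreserving_add_right volume _).setLIntegral_comp_preimage measurableSet_Ioc hg,
    hshift, ← hmap, lintegral_map (by fun_prop) (measurable_measureReal_Ioi _)]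
  refine setLIntegral_congr_fun measurableSet_Ioc fun u hu => ?_
  have hIoc : Ioi u ∩ Ioc a t = Ioc u t := by
    rw [inter_comm, Ioc_inter_Ioi, sup_eq_right.2 hu.1.le]
  rw [measureReal_restrict_apply measurableSet_Ioi, hIoc, hsplit u ⟨hu.1.le, hu.2⟩]

end TailMeasure

section TailNorm

variable {q : ℝ≥0∞} {b : ℝ → ℝ}

/-- The measure `(u ^ (-1/q) b(u)) ^ q du` on `(0, ∞)` for a finite exponent `q`. The `q`-th power
of `tailNorm q b t` is its mass on `(t, ∞)`, so the substitution `s = tailNorm q b u ^ q` carries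
it to Lebesgue measure. -/
def tailMeasure (q : ℝ≥0∞) (b : ℝ → ℝ) : Measure ℝ :=
  (volume.restrict (Ioi 0)).withDensity (fun u => weight 0 q b u ^ q.toReal)

instance nullSingletonClass_tailMeasure (q : ℝ≥0∞) (b : ℝ → ℝ) :
    NullSingletonClass (tailMeasure q b) := by
  unfold tailMeasure; infer_instance

theorem SlowlyVarying.weightedNorm_eq_lintegral (hb : SlowlyVarying b) (hq : q ≠ 0) (ht : q ≠ ∞)
    {E : Set ℝ} (hE : MeasurableSet E) (hE0 : E ⊆ Ioi 0) (φ : ℝ → ℝ≥0∞) :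
    weightedNorm q b E φ = (∫⁻ u in E, φ u ^ q.toReal ∂tailMeasure q b) ^ (1 / q.toReal) := by
  have hfin : ∀ᵐ u ∂volume.restrict E, weight 0 q b u ^ q.toReal < ∞ := ae_of_all _ fun u =>
    (ENNReal.rpow_ne_top_of_nonneg ENNReal.toReal_nonneg ENNReal.ofReal_ne_top).lt_top
  rw [weightedNorm, eLpNorm_eq_lintegral_rpow_enorm_toReal hq ht, tailMeasure,
    restrict_withDensity hE, Measure.restrict_restrict hE, inter_eq_left.2 hE0,
    lintegral_withDensity_eq_lintegral_mul_non_measurable₀ _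
      ((hb.aemeasurable_weight hE0).pow_const _) hfin]
  simp only [enorm_eq_self, Pi.mul_apply, ENNReal.mul_rpow_of_nonneg _ _ ENNReal.toReal_nonneg]

theorem SlowlyVarying.tailMeasure_Ioi (hb : SlowlyVarying b) (hq : q ≠ 0) (ht : q ≠ ∞) {t : ℝ}
    (h0 : 0 ≤ t) : tailMeasure q b (Ioi t) = tailNorm q b t ^ q.toReal := by
  rw [← weightedNorm_Ioi_one, hb.weightedNorm_eq_lintegral hq ht measurableSet_Ioi
    (Ioi_subset_Ioi h0), ← ENNReal.rpow_mul, one_div_mul_cancel (ENNReal.toReal_pos hq ht).ne']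
  simp only [Pi.one_apply, ENNReal.one_rpow, lintegral_one, Measure.restrict_apply_univ,
    ENNReal.rpow_one]

theorem SlowlyVarying.tailMeasure_real_Ioi (hb : SlowlyVarying b) (hq : q ≠ 0) (ht : q ≠ ∞)
    {t : ℝ} (h0 : 0 ≤ t) :
    (tailMeasure q b).real (Ioi t) = (tailNorm q b t).toReal ^ q.toReal := by
  rw [measureReal_def, hb.tailMeasure_Ioi hq ht h0, ENNReal.toReal_rpow]

theorem SVZero.tailMeasure_Ioi_ne_top (hb : SVZero q b) (hq : q ≠ 0) (ht : q ≠ ∞) {t : ℝ}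
    (h0 : 0 < t) : tailMeasure q b (Ioi t) ≠ ∞ := by
  rw [hb.1.tailMeasure_Ioi hq ht h0.le]
  exact ENNReal.rpow_ne_top_of_nonneg ENNReal.toReal_nonneg (hb.tailNorm_ne_top hq h0)

theorem SVZero.toReal_tailNorm_pos (hb : SVZero q b) (hq : q ≠ 0) {t : ℝ} (h0 : 0 < t) :
    0 < (tailNorm q b t).toReal :=
  ENNReal.toReal_pos (hb.1.tailNorm_ne_zero hq h0) (hb.tailNorm_ne_top hq h0)

theorem SVZero.tailMeasure_real_Ioi_pos (hb : SVZero q b) (hq : q ≠ 0) (ht : q ≠ ∞) {t : ℝ}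
    (h0 : 0 < t) : 0 < (tailMeasure q b).real (Ioi t) := by
  rw [hb.1.tailMeasure_real_Ioi hq ht h0.le]
  exact Real.rpow_pos_of_pos (hb.toReal_tailNorm_pos hq h0) _

theorem SVZero.tailNorm_rpow_rpow (hb : SVZero q b) (hq : q ≠ 0) (ht : q ≠ ∞) {t : ℝ}
    (h0 : 0 < t) (c : ℝ) : (tailNorm q b t ^ c) ^ q.toReal =
      ENNReal.ofReal ((tailMeasure q b).real (Ioi t) ^ c) := by
  have hT := hb.toReal_tailNorm_pos hq h0
  rw [hb.1.tailMeasure_real_Ioi hq ht h0.le, ← ENNReal.ofReal_rpow_of_pos (by positivity),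
    ← ENNReal.ofReal_rpow_of_pos hT, ENNReal.ofReal_toReal (hb.tailNorm_ne_top hq h0),
    ← ENNReal.rpow_mul, ← ENNReal.rpow_mul, mul_comm]

theorem SVZero.weightedNorm_tailNorm_rpow (hb : SVZero q b) (hq : q ≠ 0) (ht : q ≠ ∞)
    {E : Set ℝ} (hE : MeasurableSet E) (hE0 : E ⊆ Ioi 0) (c : ℝ) :
    weightedNorm q b E (fun u => tailNorm q b u ^ c) =
      (∫⁻ u in E, ENNReal.ofReal ((tailMeasure q b).real (Ioi u) ^ c) ∂tailMeasure q b) ^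
        (1 / q.toReal) := by
  rw [hb.1.weightedNorm_eq_lintegral hq ht hE hE0]
  congr 1
  exact setLIntegral_congr_fun hE fun u hu => hb.tailNorm_rpow_rpow hq ht (hE0 hu) c

theorem SVZero.ofReal_tailMeasure_rpow_div_rpow (hb : SVZero q b) (hq : q ≠ 0) (ht : q ≠ ∞)
    {t p ε : ℝ} (h0 : 0 < t) (hε : 0 < ε) :
    ENNReal.ofReal ((tailMeasure q b).real (Ioi t) ^ p / ε) ^ (1 / q.toReal) =
      ((1 / ε).toNNReal ^ (1 / q.toReal) : ℝ≥0) * tailNorm q b t ^ p := by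
  rw [div_eq_mul_one_div, mul_comm, ENNReal.ofReal_mul (by positivity),
    ENNReal.mul_rpow_of_nonneg _ _ (by positivity), ← hb.tailNorm_rpow_rpow hq ht h0,
    ← ENNReal.rpow_mul (tailNorm q b t ^ p), mul_one_div_cancel (ENNReal.toReal_pos hq ht).ne',
    ENNReal.rpow_one, ENNReal.coe_rpow_of_nonneg _ (by positivity)]
  rfl

theorem setLIntegral_Ioc_zero_le {μ : Measure ℝ} {f : ℝ → ℝ≥0∞} {t : ℝ} {B : ℝ≥0∞}
    (h : ∀ a, 0 < a → ∫⁻ u in Ioc a t, f u ∂μ ≤ B) : ∫⁻ u in Ioc 0 t, f u ∂μ ≤ B := by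
  have hunion : Ioc 0 t = ⋃ n : ℕ, Ioc (1 / ((n : ℝ) + 1)) t := by
    ext u
    simp only [mem_Ioc, mem_iUnion]
    refine ⟨fun ⟨hu0, hut⟩ => ?_, fun ⟨n, hnu, hut⟩ => ⟨lt_trans (by positivity) hnu, hut⟩⟩
    obtain ⟨n, hn⟩ := exists_nat_one_div_lt hu0
    exact ⟨n, hn, hut⟩
  have hdir : Directed (· ⊆ ·) (fun n : ℕ => Ioc (1 / ((n : ℝ) + 1)) t) := by
    refine Monotone.directed_le fun m n hmn => Ioc_subset_Ioc_left ?_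
    gcongr
  rw [hunion, setLIntegral_iUnion_of_directed _ hdir]
  exact iSup_le fun n => h _ (by positivity)

theorem lintegral_Ioi_rpow_neg_one_add {c ε : ℝ} (hc : 0 < c) (hε : 0 < ε) :
    ∫⁻ s in Ioi c, ENNReal.ofReal (s ^ (-(1 + ε))) = ENNReal.ofReal (c ^ (-ε) / ε) := by
  have hnonneg : ∀ᵐ s ∂volume.restrict (Ioi c), 0 ≤ s ^ (-(1 + ε)) := by
    filter_upwards [ae_restrict_mem measurableSet_Ioi] with s hs
      using Real.rpow_nonneg (hc.trans hs).le _
  rw [← ofReal_integral_eq_lintegral_ofReal (integrableOn_Ioi_rpow_of_lt (by linarith) hc) hnonneg,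
    integral_Ioi_rpow_of_lt (by linarith) hc, show -(1 + ε) + 1 = -ε by ring, neg_div_neg_eq]

theorem lintegral_Ioc_rpow_neg_one {c d : ℝ} (hc : 0 < c) (hcd : c ≤ d) :
    ∫⁻ s in Ioc c d, ENNReal.ofReal (s ^ (-1 : ℝ)) = ENNReal.ofReal (Real.log (d / c)) := by
  have h0 : (0 : ℝ) ∉ uIcc c d := by
    rw [uIcc_of_le hcd]; exact fun h => h.1.not_gt hc
  have hint : IntegrableOn (fun s : ℝ => s⁻¹) (Ioc c d) := by
    rw [← intervalIntegrable_iff_integrableOn_Ioc_of_le hcd, intervalIntegrable_inv_iff]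
    exact Or.inr h0
  have hnonneg : ∀ᵐ s ∂volume.restrict (Ioc c d), 0 ≤ s⁻¹ := by
    filter_upwards [ae_restrict_mem measurableSet_Ioc] with s hs
      using inv_nonneg.2 (hc.trans hs.1).le
  simp only [Real.rpow_neg_one]
  rw [← ofReal_integral_eq_lintegral_ofReal hint hnonneg, ← intervalIntegral.integral_of_le hcd,
    integral_inv h0]

theorem SVZero.exists_weightedNorm_top_tailNorm_rpow_le (hb : SVZero ∞ b) : ∃ C : ℝ≥0,
    ∀ (E : Set ℝ) (a : ℝ) (B : ℝ≥0∞), MeasurableSet E → E ⊆ Ioi 0 →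
      (∀ u ∈ E, tailNorm ∞ b u ^ (1 + a) ≤ B) →
        weightedNorm ∞ b E (fun u => tailNorm ∞ b u ^ a) ≤ C * B := by
  obtain ⟨C, hC⟩ := hb.1.exists_le_tailNorm ENNReal.top_ne_zero
  refine ⟨C, fun E a B hE hE0 h => ?_⟩
  rw [weightedNorm, eLpNorm_exponent_top]
  refine eLpNormEssSup_le_of_ae_enorm_bound ?_
  filter_upwards [ae_restrict_mem hE] with u hu
  have h0 := hb.1.tailNorm_ne_zero ENNReal.top_ne_zero (hE0 hu)
  have h1 := hb.tailNorm_ne_top ENNReal.top_ne_zero (hE0 hu)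
  calc ‖weight 0 ∞ b u * tailNorm ∞ b u ^ a‖ₑ
      = ENNReal.ofReal (b u) * tailNorm ∞ b u ^ a := by
        rw [enorm_eq_self, weight_zero_eq, ENNReal.inv_top, ENNReal.toReal_zero, neg_zero,
          Real.rpow_zero, one_mul]
    _ ≤ C * tailNorm ∞ b u * tailNorm ∞ b u ^ a := by gcongr; exact hC u (hE0 hu)
    _ = C * tailNorm ∞ b u ^ (1 + a) := by
        rw [mul_assoc, ENNReal.rpow_add _ _ h0 h1, ENNReal.rpow_one]
    _ ≤ C * B := by gcongr; exact h u hu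

theorem SVZero.exists_weightedNorm_Ioc_tailNorm_rpow_le (hb : SVZero q b) (hq : q ≠ 0) {ε : ℝ}
    (hε : 0 < ε) : ∃ C : ℝ≥0, ∀ t, 0 < t →
      weightedNorm q b (Ioc 0 t) (fun u => tailNorm q b u ^ (-(1 + ε))) ≤
        C * tailNorm q b t ^ (-ε) := by
  rcases eq_or_ne q ∞ with rfl | ht
  · obtain ⟨C, hC⟩ := hb.exists_weightedNorm_top_tailNorm_rpow_le
    refine ⟨C, fun t _ => hC _ _ _ measurableSet_Ioc Ioc_subset_Ioi_self fun u hu => ?_⟩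
    rw [show 1 + -(1 + ε) = -ε by ring, ENNReal.rpow_neg, ENNReal.rpow_neg]
    gcongr
    exact tailNorm_antitone hu.2
  · refine ⟨(1 / ε).toNNReal ^ (1 / q.toReal), fun t h0 => ?_⟩
    rw [hb.weightedNorm_tailNorm_rpow hq ht measurableSet_Ioc Ioc_subset_Ioi_self,
      ← hb.ofReal_tailMeasure_rpow_div_rpow hq ht h0 hε, ← lintegral_Ioi_rpow_neg_one_add
        (hb.tailMeasure_real_Ioi_pos hq ht h0) hε]
    refine ENNReal.rpow_le_rpow (setLIntegral_Ioc_zero_le fun a ha => ?_) (by positivity)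
    rcases le_or_gt a t with hat | hta
    · rw [setLIntegral_Ioc_comp_measureReal_Ioi (g := fun s => ENNReal.ofReal (s ^ (-(1 + ε))))
        (hb.tailMeasure_Ioi_ne_top hq ht ha) hat (by fun_prop)]
      exact lintegral_mono_set Ioc_subset_Ioi_self
    · rw [Ioc_eq_empty hta.not_gt, Measure.restrict_empty, lintegral_zero_measure]
      exact zero_le

theorem SVZero.exists_weightedNorm_Ioi_tailNorm_rpow_le (hb : SVZero q b) (hq : q ≠ 0) {p : ℝ}
    (hp : 0 < p) : ∃ C : ℝ≥0, ∀ t, 0 < t →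
      weightedNorm q b (Ioi t) (fun u => tailNorm q b u ^ (p - 1)) ≤ C * tailNorm q b t ^ p := by
  rcases eq_or_ne q ∞ with rfl | ht
  · obtain ⟨C, hC⟩ := hb.exists_weightedNorm_top_tailNorm_rpow_le
    refine ⟨C, fun t ht => hC _ _ _ measurableSet_Ioi (Ioi_subset_Ioi ht.le) fun u hu => ?_⟩
    rw [add_sub_cancel]
    exact ENNReal.rpow_le_rpow (tailNorm_antitone (le_of_lt hu)) hp.le
  · refine ⟨(1 / p).toNNReal ^ (1 / q.toReal), fun t h0 => le_of_eq ?_⟩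
    rw [hb.weightedNorm_tailNorm_rpow hq ht measurableSet_Ioi (Ioi_subset_Ioi h0.le),
      ← hb.ofReal_tailMeasure_rpow_div_rpow hq ht h0 hp, 
      ← lintegral_Ioc_zero_rpow_sub_one (hb.tailMeasure_real_Ioi_pos hq ht h0) hp,
      setLIntegral_Ioi_comp_measureReal_Ioi (g := fun s => ENNReal.ofReal (s ^ (p - 1)))
        (hb.tailMeasure_Ioi_ne_top hq ht h0) (by fun_prop)]

theorem SVZero.weightedNorm_Ioc_tailNorm_inv (hb : SVZero q b) (hq : q ≠ 0) (ht : q ≠ ∞) {a t : ℝ}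
    (ha : 0 < a) (hat : a ≤ t) :
    weightedNorm q b (Ioc a t) (fun u => (tailNorm q b u)⁻¹) =
      ENNReal.ofReal (q.toReal * Real.log ((tailNorm q b a).toReal / (tailNorm q b t).toReal)) ^
        (1 / q.toReal) := by
  have hTa := hb.toReal_tailNorm_pos hq ha
  have hTt := hb.toReal_tailNorm_pos hq (ha.trans_le hat)
  have hFta : (tailMeasure q b).real (Ioi t) ≤ (tailMeasure q b).real (Ioi a) :=
    measureReal_mono (Ioi_subset_Ioi hat) (hb.tailMeasure_Ioi_ne_top hq ht ha)
  simp only [← ENNReal.rpow_neg_one]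
  rw [hb.weightedNorm_tailNorm_rpow hq ht measurableSet_Ioc fun u hu => ha.trans hu.1,
    setLIntegral_Ioc_comp_measureReal_Ioi (g := fun s => ENNReal.ofReal (s ^ (-1 : ℝ)))
      (hb.tailMeasure_Ioi_ne_top hq ht ha) hat (by fun_prop),
    lintegral_Ioc_rpow_neg_one (hb.tailMeasure_real_Ioi_pos hq ht (ha.trans_le hat)) hFta,
    hb.1.tailMeasure_real_Ioi hq ht ha.le, hb.1.tailMeasure_real_Ioi hq ht (ha.le.trans hat),
    ← Real.div_rpow hTa.le hTt.le, Real.log_rpow (div_pos hTa hTt)]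

theorem SVZero.continuousOn_toReal_tailNorm (hb : SVZero q b) (hq : q ≠ 0) (ht : q ≠ ∞) {a : ℝ}
    (ha : 0 < a) : ContinuousOn (fun u => (tailNorm q b u).toReal) (Ici a) := by
  have hcont := (continuousOn_measureReal_Ioi (hb.tailMeasure_Ioi_ne_top hq ht ha)).rpow_const
    (p := 1 / q.toReal) fun x _ => Or.inr (by positivity)
  refine hcont.congr fun u hu => ?_
  beta_reduce
  rw [hb.1.tailMeasure_real_Ioi hq ht (ha.le.trans hu), ← Real.rpow_mul ENNReal.toReal_nonneg,
    mul_one_div_cancel (ENNReal.toReal_pos hq ht).ne', Real.rpow_one]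

end TailNorm

section kFunctional

variable {V : Type*} [Add V] {S₀ S₁ : Set V} {N₀ N₁ : V → ℝ≥0∞} {t : ℝ≥0∞} {f g : V} {x : ℝ≥0∞}

theorem kFunctional_le {f₀ f₁ : V} (h₀ : f₀ ∈ S₀) (h₁ : f₁ ∈ S₁) (h : f = f₀ + f₁) :
    kFunctional S₀ S₁ N₀ N₁ t f ≤ N₀ f₀ + t * N₁ f₁ :=
  iInf₂_le_of_le f₀ h₀ (iInf₂_le_of_le f₁ h₁ (iInf_le_of_le h le_rfl))

theorem le_kFunctional (h : ∀ f₀ ∈ S₀, ∀ f₁ ∈ S₁, f = f₀ + f₁ → x ≤ N₀ f₀ + t * N₁ f₁) :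
    x ≤ kFunctional S₀ S₁ N₀ N₁ t f :=
  le_iInf₂ fun f₀ h₀ => le_iInf₂ fun f₁ h₁ => le_iInf fun e => h f₀ h₀ f₁ h₁ e

theorem le_kFunctional_add_kFunctional
    (h : ∀ f₀ ∈ S₀, ∀ f₁ ∈ S₁, f = f₀ + f₁ → ∀ g₀ ∈ S₀, ∀ g₁ ∈ S₁, g = g₀ + g₁ →
      x ≤ (N₀ f₀ + t * N₁ f₁) + (N₀ g₀ + t * N₁ g₁)) :
    x ≤ kFunctional S₀ S₁ N₀ N₁ t f + kFunctional S₀ S₁ N₀ N₁ t g := by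
  rw [← tsub_le_iff_right]
  refine le_kFunctional fun f₀ h₀ f₁ h₁ e => ?_
  rw [tsub_le_iff_tsub_le]
  refine le_kFunctional fun g₀ h₀' g₁ h₁' e' => ?_
  rw [tsub_le_iff_left]
  exact h f₀ h₀ f₁ h₁ e g₀ h₀' g₁ h₁' e'

theorem le_mul_kFunctional {c : ℝ≥0∞} (hc : c ≠ 0) (hc' : c ≠ ∞)
    (h : ∀ f₀ ∈ S₀, ∀ f₁ ∈ S₁, f = f₀ + f₁ → x ≤ c * (N₀ f₀ + t * N₁ f₁)) :
    x ≤ c * kFunctional S₀ S₁ N₀ N₁ t f := by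
  rw [mul_comm, ← ENNReal.div_le_iff hc hc']
  refine le_kFunctional fun f₀ h₀ f₁ h₁ e => ?_
  rw [ENNReal.div_le_iff hc hc', mul_comm]
  exact h f₀ h₀ f₁ h₁ e

theorem exists_of_kFunctional_lt (h : kFunctional S₀ S₁ N₀ N₁ t f < x) :
    ∃ f₀ ∈ S₀, ∃ f₁ ∈ S₁, f = f₀ + f₁ ∧ N₀ f₀ + t * N₁ f₁ < x := by
  by_contra! h'
  exact (le_kFunctional h').not_gt h

end kFunctional

section Couple

variable {𝕜 V : Type*} [RCLike 𝕜] [AddCommGroup V] [Module 𝕜 V] [TopologicalSpace V]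

theorem QuasiNormedSubspace.qnorm_zero (A : QuasiNormedSubspace 𝕜 V) : A.qnorm 0 = 0 := by
  simpa using A.smul 0 0 A.toSubmodule.zero_mem

theorem QuasiNormedSubspace.qnorm_neg (A : QuasiNormedSubspace 𝕜 V) {x : V}
    (hx : x ∈ A.toSubmodule) : A.qnorm (-x) = A.qnorm x := by
  simpa using A.smul (-1) x hx

theorem QuasiNormedSubspace.exists_ofReal_qnorm_add_le (A : QuasiNormedSubspace 𝕜 V) :
    ∃ C : ℝ≥0, ∀ x ∈ A.toSubmodule, ∀ y ∈ A.toSubmodule, ENNReal.ofReal (A.qnorm (x + y)) ≤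
      C * (ENNReal.ofReal (A.qnorm x) + ENNReal.ofReal (A.qnorm y)) := by
  obtain ⟨C, hC⟩ := A.add_le
  refine ⟨C.toNNReal, fun x hx y hy => ?_⟩
  have hx0 := A.nonneg x hx
  have hy0 := A.nonneg y hy
  calc ENNReal.ofReal (A.qnorm (x + y)) ≤ ENNReal.ofReal (C * (A.qnorm x + A.qnorm y)) :=
        ENNReal.ofReal_le_ofReal (hC x hx y hy)
    _ = ENNReal.ofReal C * (ENNReal.ofReal (A.qnorm x) + ENNReal.ofReal (A.qnorm y)) := by
        rw [ENNReal.ofReal_mul' (by positivity), ENNReal.ofReal_add hx0 hy0]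

variable (A₀ A₁ : QuasiNormedSubspace 𝕜 V)

theorem K_mono (f : V) : Monotone (fun t => K A₀ A₁ t f) := fun _ _ hst =>
  le_kFunctional fun _ h₀ _ h₁ e => (kFunctional_le h₀ h₁ e).trans (by gcongr)

theorem ofReal_mul_K_le {s t : ℝ} (hs : 0 < s) (hst : s ≤ t) (f : V) :
    ENNReal.ofReal s * K A₀ A₁ t f ≤ ENNReal.ofReal t * K A₀ A₁ s f := by
  have ht := hs.trans_le hst
  refine le_mul_kFunctional (by simpa using ht) ENNReal.ofReal_ne_top fun f₀ h₀ f₁ h₁ e => ?_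
  calc ENNReal.ofReal s * K A₀ A₁ t f
      ≤ ENNReal.ofReal s * (ENNReal.ofReal (A₀.qnorm f₀) +
          ENNReal.ofReal t * ENNReal.ofReal (A₁.qnorm f₁)) := by
        gcongr; exact kFunctional_le h₀ h₁ e
    _ = ENNReal.ofReal s * ENNReal.ofReal (A₀.qnorm f₀) +
          ENNReal.ofReal t * (ENNReal.ofReal s * ENNReal.ofReal (A₁.qnorm f₁)) := by ring
    _ ≤ ENNReal.ofReal t * ENNReal.ofReal (A₀.qnorm f₀) +
          ENNReal.ofReal t * (ENNReal.ofReal s * ENNReal.ofReal (A₁.qnorm f₁)) := by gcongr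
    _ = _ := by ring

theorem K_ne_top {f : V} (hf : f ∈ A₀.toSubmodule ⊔ A₁.toSubmodule) (t : ℝ) :
    K A₀ A₁ t f ≠ ∞ := by
  obtain ⟨f₀, h₀, f₁, h₁, rfl⟩ := Submodule.mem_sup.1 hf
  exact ne_top_of_le_ne_top (by finiteness) (kFunctional_le h₀ h₁ rfl)

theorem exists_K_add_le : ∃ C : ℝ≥0, ∀ (t : ℝ) (f g : V),
    K A₀ A₁ t (f + g) ≤ C * (K A₀ A₁ t f + K A₀ A₁ t g) := by
  obtain ⟨C₀, hC₀⟩ := A₀.exists_ofReal_qnorm_add_le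
  obtain ⟨C₁, hC₁⟩ := A₁.exists_ofReal_qnorm_add_le
  set C : ℝ≥0 := max C₀ C₁ + 1
  have hC : (C : ℝ≥0∞) ≠ 0 := by
    rw [ENNReal.coe_ne_zero]; positivity
  have hC₀' : C₀ ≤ C := (le_max_left _ _).trans le_self_add
  have hC₁' : C₁ ≤ C := (le_max_right _ _).trans le_self_add
  refine ⟨C, fun t f g => ?_⟩
  rw [mul_comm, ← ENNReal.div_le_iff hC ENNReal.coe_ne_top]
  refine le_kFunctional_add_kFunctional fun f₀ hf₀ f₁ hf₁ ef g₀ hg₀ g₁ hg₁ eg => ?_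
  rw [ENNReal.div_le_iff hC ENNReal.coe_ne_top]
  calc K A₀ A₁ t (f + g)
      ≤ ENNReal.ofReal (A₀.qnorm (f₀ + g₀)) +
          ENNReal.ofReal t * ENNReal.ofReal (A₁.qnorm (f₁ + g₁)) :=
        kFunctional_le (add_mem hf₀ hg₀) (add_mem hf₁ hg₁) (by rw [ef, eg, add_add_add_comm])
    _ ≤ C * (ENNReal.ofReal (A₀.qnorm f₀) + ENNReal.ofReal (A₀.qnorm g₀)) +
          ENNReal.ofReal t * (C * (ENNReal.ofReal (A₁.qnorm f₁) +
            ENNReal.ofReal (A₁.qnorm g₁))) := by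
        gcongr
        · exact (hC₀ _ hf₀ _ hg₀).trans (by gcongr)
        · exact (hC₁ _ hf₁ _ hg₁).trans (by gcongr)
    _ = _ := by ring

theorem K_neg_le (t : ℝ) (f : V) : K A₀ A₁ t (-f) ≤ K A₀ A₁ t f :=
  le_kFunctional fun _ h₀ _ h₁ e =>
    (kFunctional_le (neg_mem h₀) (neg_mem h₁) (by rw [e, neg_add])).trans_eq
      (by rw [A₀.qnorm_neg h₀, A₁.qnorm_neg h₁])

theorem exists_K_sub_le : ∃ C : ℝ≥0, ∀ (t : ℝ) (f g : V),
    K A₀ A₁ t (f - g) ≤ C * (K A₀ A₁ t f + K A₀ A₁ t g) := by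
  obtain ⟨C, hC⟩ := exists_K_add_le A₀ A₁
  refine ⟨C, fun t f g => ?_⟩
  rw [sub_eq_add_neg]
  exact (hC t f (-g)).trans (by gcongr; exact K_neg_le A₀ A₁ t g)

theorem K_le_qnorm_left {f : V} (hf : f ∈ A₀.toSubmodule) (t : ℝ) :
    K A₀ A₁ t f ≤ ENNReal.ofReal (A₀.qnorm f) := by
  refine (kFunctional_le (f₁ := 0) hf A₁.toSubmodule.zero_mem (add_zero f).symm).trans_eq ?_
  rw [A₁.qnorm_zero, ENNReal.ofReal_zero, mul_zero, add_zero]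

theorem K_le_qnorm_right {f : V} (hf : f ∈ A₁.toSubmodule) (t : ℝ) :
    K A₀ A₁ t f ≤ ENNReal.ofReal t * ENNReal.ofReal (A₁.qnorm f) := by
  refine (kFunctional_le (f₀ := 0) A₀.toSubmodule.zero_mem hf (zero_add f).symm).trans_eq ?_
  rw [A₀.qnorm_zero, ENNReal.ofReal_zero, zero_add]

theorem eq_zero_of_K_eq_zero [IsTopologicalAddGroup V] [T2Space V] {t : ℝ} (ht : 0 < t) {f : V}
    (h : K A₀ A₁ t f = 0) : f = 0 := by
  by_contra hf
  obtain ⟨W, hWo, hW0, hW⟩ :=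
    exists_open_nhds_zero_add_subset (isOpen_ne.mem_nhds (Ne.symm hf) : {x | x ≠ f} ∈ 𝓝 (0 : V))
  obtain ⟨δ₀, hδ₀, h₀⟩ := A₀.continuous_embedding W (hWo.mem_nhds hW0)
  obtain ⟨δ₁, hδ₁, h₁⟩ := A₁.continuous_embedding W (hWo.mem_nhds hW0)
  have hpos : 0 < min δ₀ (t * δ₁) := by positivity
  have hlt : K A₀ A₁ t f < ENNReal.ofReal (min δ₀ (t * δ₁)) := by
    rw [h]; exact ENNReal.ofReal_pos.2 hpos
  obtain ⟨f₀, hf₀, f₁, hf₁, e, hv⟩ := exists_of_kFunctional_lt hlt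
  have hn₀ := A₀.nonneg f₀ hf₀
  have hn₁ := mul_nonneg ht.le (A₁.nonneg f₁ hf₁)
  rw [← ENNReal.ofReal_mul ht.le, ← ENNReal.ofReal_add hn₀ hn₁,
    ENNReal.ofReal_lt_ofReal_iff hpos, lt_min_iff] at hv
  have hm₀ : f₀ ∈ W := h₀ f₀ hf₀ (by linarith [hv.1])
  have hm₁ : f₁ ∈ W := h₁ f₁ hf₁ (lt_of_mul_lt_mul_left (by linarith [hv.2]) ht.le)
  exact hW (add_mem_add hm₀ hm₁) e.symm

theorem K_mul_tailNorm_le {f : V} (hf : f ∈ A₀.toSubmodule ⊔ A₁.toSubmodule) (q : ℝ≥0∞)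
    (b : ℝ → ℝ) (t : ℝ) :
    K A₀ A₁ t f * tailNorm q b t ≤ kNorm A₀ A₁ 0 q b (Ioi t) f :=
  const_mul_tailNorm_le (K_ne_top A₀ A₁ hf t) fun _ hu => K_mono A₀ A₁ f (mem_Ioi.1 hu).le

/-- A decomposition `f = f₀ + f₁` that attains `K(t, f)` up to the factor `2`. The two norms are
bounded separately, so that the definition also makes sense for `K(t, f) = 0`. -/
structure NearOptimal (t : ℝ) (f f₀ f₁ : V) : Prop where
  left_mem : f₀ ∈ A₀.toSubmodule
  right_mem : f₁ ∈ A₁.toSubmodule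
  eq_add : f = f₀ + f₁
  left_le : ENNReal.ofReal (A₀.qnorm f₀) ≤ 2 * K A₀ A₁ t f
  right_le : ENNReal.ofReal t * ENNReal.ofReal (A₁.qnorm f₁) ≤ 2 * K A₀ A₁ t f

theorem exists_nearOptimal [IsTopologicalAddGroup V] [T2Space V] {t : ℝ} (ht : 0 < t) {f : V}
    (hf : f ∈ A₀.toSubmodule ⊔ A₁.toSubmodule) : ∃ f₀ f₁, NearOptimal A₀ A₁ t f f₀ f₁ := by
  rcases eq_or_ne (K A₀ A₁ t f) 0 with h | h
  · obtain rfl := eq_zero_of_K_eq_zero A₀ A₁ ht h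
    exact ⟨0, 0, zero_mem _, zero_mem _, (add_zero 0).symm, by simp [A₀.qnorm_zero],
      by simp [A₁.qnorm_zero]⟩
  · have hlt : K A₀ A₁ t f < 2 * K A₀ A₁ t f := by
      rw [two_mul]; exact ENNReal.lt_add_right (K_ne_top A₀ A₁ hf t) h
    obtain ⟨f₀, hf₀, f₁, hf₁, e, hv⟩ := exists_of_kFunctional_lt hlt
    exact ⟨f₀, f₁, hf₀, hf₁, e, le_self_add.trans hv.le, le_add_self.trans hv.le⟩

section NearOptimal

variable {A₀ A₁} {t : ℝ} {f f₀ f₁ : V}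

theorem NearOptimal.K_left_le (h : NearOptimal A₀ A₁ t f f₀ f₁) (u : ℝ) :
    K A₀ A₁ u f₀ ≤ 2 * K A₀ A₁ t f :=
  (K_le_qnorm_left A₀ A₁ h.left_mem u).trans h.left_le

theorem NearOptimal.ofReal_mul_K_right_le (h : NearOptimal A₀ A₁ t f f₀ f₁) (u : ℝ) :
    ENNReal.ofReal t * K A₀ A₁ u f₁ ≤ ENNReal.ofReal u * (2 * K A₀ A₁ t f) :=
  calc ENNReal.ofReal t * K A₀ A₁ u f₁
      ≤ ENNReal.ofReal t * (ENNReal.ofReal u * ENNReal.ofReal (A₁.qnorm f₁)) := by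
        gcongr; exact K_le_qnorm_right A₀ A₁ h.right_mem u
    _ = ENNReal.ofReal u * (ENNReal.ofReal t * ENNReal.ofReal (A₁.qnorm f₁)) := by ring
    _ ≤ ENNReal.ofReal u * (2 * K A₀ A₁ t f) := mul_le_mul_right h.right_le _

theorem NearOptimal.mem_sup (h : NearOptimal A₀ A₁ t f f₀ f₁) :
    f ∈ A₀.toSubmodule ⊔ A₁.toSubmodule :=
  h.eq_add ▸ Submodule.add_mem_sup h.left_mem h.right_mem

variable (A₀ A₁) in
theorem NearOptimal.exists_K_left_le_mul : ∃ C : ℝ≥0, ∀ {t : ℝ} {f f₀ f₁ : V},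
    NearOptimal A₀ A₁ t f f₀ f₁ → ∀ u ∈ Ioo 0 t, K A₀ A₁ u f₀ ≤ C * K A₀ A₁ u f := by
  obtain ⟨C, hC⟩ := exists_K_sub_le A₀ A₁
  refine ⟨C * 3, fun {t f f₀ f₁} h u hu => ?_⟩
  have ht : ENNReal.ofReal t ≠ 0 := by simpa using hu.1.trans hu.2
  have hright : K A₀ A₁ u f₁ ≤ 2 * K A₀ A₁ u f := by
    refine (ENNReal.mul_le_mul_iff_right ht ENNReal.ofReal_ne_top).1 ?_
    calc ENNReal.ofReal t * K A₀ A₁ u f₁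
        ≤ ENNReal.ofReal u * (2 * K A₀ A₁ t f) := h.ofReal_mul_K_right_le u
      _ = 2 * (ENNReal.ofReal u * K A₀ A₁ t f) := mul_left_comm _ _ _
      _ ≤ 2 * (ENNReal.ofReal t * K A₀ A₁ u f) := by
          gcongr 2 * ?_; exact ofReal_mul_K_le A₀ A₁ hu.1 hu.2.le f
      _ = ENNReal.ofReal t * (2 * K A₀ A₁ u f) := mul_left_comm _ _ _
  calc K A₀ A₁ u f₀ = K A₀ A₁ u (f - f₁) := by rw [h.eq_add, add_sub_cancel_right]
    _ ≤ C * (K A₀ A₁ u f + K A₀ A₁ u f₁) := hC u f f₁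
    _ ≤ C * (K A₀ A₁ u f + 2 * K A₀ A₁ u f) := by gcongr
    _ = (C * 3 : ℝ≥0) * K A₀ A₁ u f := by push_cast; ring

variable (A₀ A₁) in
theorem NearOptimal.exists_K_right_le_mul : ∃ C : ℝ≥0, ∀ {t : ℝ} {f f₀ f₁ : V},
    NearOptimal A₀ A₁ t f f₀ f₁ → ∀ u ∈ Ioi t, K A₀ A₁ u f₁ ≤ C * K A₀ A₁ u f := by
  obtain ⟨C, hC⟩ := exists_K_sub_le A₀ A₁
  refine ⟨C * 3, fun {t f f₀ f₁} h u hu => ?_⟩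
  have hleft : K A₀ A₁ u f₀ ≤ 2 * K A₀ A₁ u f :=
    (h.K_left_le u).trans (mul_le_mul_right (K_mono A₀ A₁ f (mem_Ioi.1 hu).le) _)
  calc K A₀ A₁ u f₁ = K A₀ A₁ u (f - f₀) := by rw [h.eq_add, add_sub_cancel_left]
    _ ≤ C * (K A₀ A₁ u f + K A₀ A₁ u f₀) := hC u f f₀
    _ ≤ C * (K A₀ A₁ u f + 2 * K A₀ A₁ u f) := by gcongr
    _ = (C * 3 : ℝ≥0) * K A₀ A₁ u f := by push_cast; ring

end NearOptimal

end Couple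

section UpperEstimate

variable {q₀ q₁ : ℝ≥0∞} {b₀ b₁ : ℝ → ℝ}

theorem rho_mul_tailNorm (hq₁ : q₁ ≠ 0) (hb₁ : SVZero q₁ b₁) {t : ℝ} (ht : 0 < t) :
    rho q₀ q₁ b₀ b₁ t * tailNorm q₁ b₁ t = tailNorm q₀ b₀ t :=
  ENNReal.div_mul_cancel (hb₁.1.tailNorm_ne_zero hq₁ ht) (hb₁.tailNorm_ne_top hq₁ ht)

theorem rho_ne_zero (hq₀ : q₀ ≠ 0) (hq₁ : q₁ ≠ 0) (hb₀ : SlowlyVarying b₀) (hb₁ : SVZero q₁ b₁)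
    {t : ℝ} (ht : 0 < t) : rho q₀ q₁ b₀ b₁ t ≠ 0 :=
  ENNReal.div_ne_zero.2 ⟨hb₀.tailNorm_ne_zero hq₀ ht, hb₁.tailNorm_ne_top hq₁ ht⟩

theorem rho_ne_top (hq₀ : q₀ ≠ 0) (hq₁ : q₁ ≠ 0) (hb₀ : SVZero q₀ b₀) (hb₁ : SlowlyVarying b₁)
    {t : ℝ} (ht : 0 < t) : rho q₀ q₁ b₀ b₁ t ≠ ∞ :=
  ENNReal.div_ne_top (hb₀.tailNorm_ne_top hq₀ ht) (hb₁.tailNorm_ne_zero hq₁ ht)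

variable {𝕜 V : Type*} [RCLike 𝕜] [AddCommGroup V] [Module 𝕜 V] [TopologicalSpace V]
  (A₀ A₁ : QuasiNormedSubspace 𝕜 V)

theorem interpNorm_zero_eq (q : ℝ≥0∞) (b : ℝ → ℝ) (f : V) :
    interpNorm A₀ A₁ 0 q b f = weightedNorm q b (Ioi 0) (fun u => K A₀ A₁ u f) := rfl

theorem NearOptimal.exists_interpNorm_left_le (q₀ : ℝ≥0∞) (b₀ : ℝ → ℝ) (hq₁ : q₁ ≠ 0)
    (hb₁ : SVZero q₁ b₁) :
    ∃ C : ℝ≥0, ∀ {t : ℝ} {f f₀ f₁ : V}, 0 < t → NearOptimal A₀ A₁ t f f₀ f₁ →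
      interpNorm A₀ A₁ 0 q₀ b₀ f₀ ≤ C * (kNorm A₀ A₁ 0 q₀ b₀ (Ioo 0 t) f +
        rho q₀ q₁ b₀ b₁ t * kNorm A₀ A₁ 0 q₁ b₁ (Ioi t) f) := by
  obtain ⟨C, hC⟩ := NearOptimal.exists_K_left_le_mul A₀ A₁
  obtain ⟨D, hD⟩ := exists_weightedNorm_union_le q₀ b₀
  refine ⟨D * (C + 2), fun {t f f₀ f₁} ht h => ?_⟩
  set I := kNorm A₀ A₁ 0 q₀ b₀ (Ioo 0 t) f
  set J := kNorm A₀ A₁ 0 q₁ b₁ (Ioi t) f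
  have hnear : weightedNorm q₀ b₀ (Ioc 0 t) (fun u => K A₀ A₁ u f₀) ≤ C * I := by
    rw [← weightedNorm_Ioo_eq_Ioc]
    exact weightedNorm_le_mul ENNReal.coe_ne_top measurableSet_Ioo (hC h)
  have hfar : weightedNorm q₀ b₀ (Ioi t) (fun u => K A₀ A₁ u f₀) ≤
      2 * (rho q₀ q₁ b₀ b₁ t * J) := by
    calc weightedNorm q₀ b₀ (Ioi t) (fun u => K A₀ A₁ u f₀)
        ≤ 2 * K A₀ A₁ t f * tailNorm q₀ b₀ t :=
          weightedNorm_const_Ioi_le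
            (ENNReal.mul_ne_top ENNReal.ofNat_ne_top (K_ne_top A₀ A₁ h.mem_sup t))
            fun u _ => h.K_left_le u
      _ = 2 * (rho q₀ q₁ b₀ b₁ t * (K A₀ A₁ t f * tailNorm q₁ b₁ t)) := by
          rw [← rho_mul_tailNorm hq₁ hb₁ ht]; ring
      _ ≤ 2 * (rho q₀ q₁ b₀ b₁ t * J) := by
          gcongr; exact K_mul_tailNorm_le A₀ A₁ h.mem_sup q₁ b₁ t
  rw [interpNorm_zero_eq, ← Ioc_union_Ioi_eq_Ioi ht.le]
  calc weightedNorm q₀ b₀ (Ioc 0 t ∪ Ioi t) (fun u => K A₀ A₁ u f₀)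
      ≤ D * (C * I + 2 * (rho q₀ q₁ b₀ b₁ t * J)) := (hD _ _ _).trans (by gcongr)
    _ ≤ D * ((C + 2) * I + (C + 2) * (rho q₀ q₁ b₀ b₁ t * J)) := by
        gcongr
        · exact le_self_add
        · exact le_add_self
    _ = (D * (C + 2) : ℝ≥0) * (I + rho q₀ q₁ b₀ b₁ t * J) := by push_cast; ring

theorem NearOptimal.exists_interpNorm_right_le (hq₁ : q₁ ≠ 0) (hb₁ : SlowlyVarying b₁) :
    ∃ C : ℝ≥0, ∀ {t : ℝ} {f f₀ f₁ : V}, 0 < t → NearOptimal A₀ A₁ t f f₀ f₁ →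
      interpNorm A₀ A₁ 0 q₁ b₁ f₁ ≤ C * kNorm A₀ A₁ 0 q₁ b₁ (Ioi t) f := by
  obtain ⟨C, hC⟩ := NearOptimal.exists_K_right_le_mul A₀ A₁
  obtain ⟨D, hD⟩ := exists_weightedNorm_union_le q₁ b₁
  obtain ⟨E, hE⟩ := hb₁.exists_weightedNorm_id_le_tailNorm hq₁
  refine ⟨D * (2 * E + C), fun {t f f₀ f₁} ht h => ?_⟩
  set J := kNorm A₀ A₁ 0 q₁ b₁ (Ioi t) f
  have ht0 : ENNReal.ofReal t ≠ 0 := by simpa using ht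
  have hnear : weightedNorm q₁ b₁ (Ioc 0 t) (fun u => K A₀ A₁ u f₁) ≤ 2 * E * J := by
    refine (ENNReal.mul_le_mul_iff_right ht0 ENNReal.ofReal_ne_top).1 ?_
    calc ENNReal.ofReal t * weightedNorm q₁ b₁ (Ioc 0 t) (fun u => K A₀ A₁ u f₁)
        ≤ weightedNorm q₁ b₁ (Ioc 0 t) (fun u => ENNReal.ofReal u * (2 * K A₀ A₁ t f)) :=
          mul_weightedNorm_le ENNReal.ofReal_ne_top measurableSet_Ioc
            fun u _ => h.ofReal_mul_K_right_le u
      _ ≤ 2 * K A₀ A₁ t f * weightedNorm q₁ b₁ (Ioc 0 t) ENNReal.ofReal :=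
          weightedNorm_le_mul
            (ENNReal.mul_ne_top ENNReal.ofNat_ne_top (K_ne_top A₀ A₁ h.mem_sup t))
            measurableSet_Ioc fun u _ => (mul_comm _ _).le
      _ ≤ 2 * K A₀ A₁ t f * (E * (ENNReal.ofReal t * tailNorm q₁ b₁ t)) := by
          gcongr; exact hE t ht
      _ = ENNReal.ofReal t * (2 * E * (K A₀ A₁ t f * tailNorm q₁ b₁ t)) := by ring
      _ ≤ ENNReal.ofReal t * (2 * E * J) := by
          gcongr; exact K_mul_tailNorm_le A₀ A₁ h.mem_sup q₁ b₁ t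
  have hfar : weightedNorm q₁ b₁ (Ioi t) (fun u => K A₀ A₁ u f₁) ≤ C * J :=
    weightedNorm_le_mul ENNReal.coe_ne_top measurableSet_Ioi (hC h)
  rw [interpNorm_zero_eq, ← Ioc_union_Ioi_eq_Ioi ht.le]
  calc weightedNorm q₁ b₁ (Ioc 0 t ∪ Ioi t) (fun u => K A₀ A₁ u f₁)
      ≤ D * (2 * E * J + C * J) := (hD _ _ _).trans (by gcongr)
    _ = (D * (2 * E + C) : ℝ≥0) * J := by push_cast; ring

theorem exists_interpK_le [IsTopologicalAddGroup V] [T2Space V] (hq₀ : q₀ ≠ 0) (hq₁ : q₁ ≠ 0)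
    (hb₀ : SlowlyVarying b₀) (hb₁ : SVZero q₁ b₁) :
    ∃ C : ℝ≥0, ∀ (f : V) (t : ℝ), f ∈ A₀.toSubmodule ⊔ A₁.toSubmodule → 0 < t →
      interpK A₀ A₁ q₀ q₁ b₀ b₁ (rho q₀ q₁ b₀ b₁ t) f ≤
        C * (kNorm A₀ A₁ 0 q₀ b₀ (Ioo 0 t) f +
          rho q₀ q₁ b₀ b₁ t * kNorm A₀ A₁ 0 q₁ b₁ (Ioi t) f) := by
  obtain ⟨C₀, hC₀⟩ := NearOptimal.exists_interpNorm_left_le A₀ A₁ q₀ b₀ hq₁ hb₁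
  obtain ⟨C₁, hC₁⟩ := NearOptimal.exists_interpNorm_right_le A₀ A₁ hq₁ hb₁.1
  refine ⟨1 + C₀ + C₁, fun f t hf ht => ?_⟩
  set ρ := rho q₀ q₁ b₀ b₁ t
  set I := kNorm A₀ A₁ 0 q₀ b₀ (Ioo 0 t) f
  set J := kNorm A₀ A₁ 0 q₁ b₁ (Ioi t) f
  have hC : ((1 + C₀ + C₁ : ℝ≥0) : ℝ≥0∞) ≠ 0 := by
    rw [ENNReal.coe_ne_zero]; positivity
  rcases eq_or_ne (I + ρ * J) ∞ with htop | hfin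
  · rw [htop, ENNReal.mul_top hC]
    exact le_top
  obtain ⟨f₀, f₁, h⟩ := exists_nearOptimal A₀ A₁ ht hf
  have hJ : J ≠ ∞ := fun hJ => (ENNReal.add_ne_top.1 hfin).2
    (by rw [hJ, ENNReal.mul_top (rho_ne_zero hq₀ hq₁ hb₀ hb₁ ht)])
  have hf₀ : f₀ ∈ interpSpace A₀ A₁ 0 q₀ b₀ := ⟨Submodule.mem_sup_left h.left_mem,
    (hC₀ ht h).trans_lt (ENNReal.mul_lt_top ENNReal.coe_lt_top hfin.lt_top)⟩
  have hf₁ : f₁ ∈ interpSpace A₀ A₁ 0 q₁ b₁ := ⟨Submodule.mem_sup_right h.right_mem,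
    (hC₁ ht h).trans_lt (ENNReal.mul_lt_top ENNReal.coe_lt_top hJ.lt_top)⟩
  calc interpK A₀ A₁ q₀ q₁ b₀ b₁ ρ f
      ≤ interpNorm A₀ A₁ 0 q₀ b₀ f₀ + ρ * interpNorm A₀ A₁ 0 q₁ b₁ f₁ :=
        kFunctional_le hf₀ hf₁ h.eq_add
    _ ≤ C₀ * (I + ρ * J) + ρ * (C₁ * J) := by gcongr; exacts [hC₀ ht h, hC₁ ht h]
    _ = C₀ * (I + ρ * J) + C₁ * (ρ * J) := by ring
    _ ≤ C₀ * (I + ρ * J) + C₁ * (I + ρ * J) := by gcongr; exact le_add_self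
    _ ≤ (1 + C₀ + C₁ : ℝ≥0) * (I + ρ * J) := by
        rw [← add_mul]; push_cast; gcongr; exact le_add_self

end UpperEstimate

section RhoCondition

variable {q₀ q₁ : ℝ≥0∞} {b₀ b₁ : ℝ → ℝ}

theorem rhoEps_eq_rho_mul (hq₀ : q₀ ≠ 0) (hb₀ : SVZero q₀ b₀) (ε : ℝ) {t : ℝ} (ht : 0 < t) :
    rhoEps ε q₀ q₁ b₀ b₁ t = rho q₀ q₁ b₀ b₁ t * tailNorm q₀ b₀ t ^ ε := by
  rw [rhoEps, rho, ENNReal.rpow_add _ _ (hb₀.1.tailNorm_ne_zero hq₀ ht)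
    (hb₀.tailNorm_ne_top hq₀ ht), ENNReal.rpow_one, ENNReal.mul_div_right_comm]

theorem rhoEps_rpow_inv (hq₁ : q₁ ≠ 0) (hb₁ : SVZero q₁ b₁) {ε : ℝ} (hε : 0 < 1 + ε) {t : ℝ}
    (ht : 0 < t) : rhoEps ε q₀ q₁ b₀ b₁ t ^ (1 + ε)⁻¹ =
      rho q₀ q₁ b₀ b₁ t * tailNorm q₁ b₁ t ^ (1 - (1 + ε)⁻¹) := by
  rw [rhoEps, rho, ENNReal.div_rpow_of_nonneg _ _ (inv_nonneg.2 hε.le),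
    ENNReal.rpow_rpow_inv hε.ne', div_eq_mul_inv, div_eq_mul_inv, mul_assoc, ← ENNReal.rpow_neg,
    ← ENNReal.rpow_neg_one (tailNorm q₁ b₁ t),
    ← ENNReal.rpow_add _ _ (hb₁.1.tailNorm_ne_zero hq₁ ht) (hb₁.tailNorm_ne_top hq₁ ht),
    sub_eq_add_neg, neg_add_cancel_left]

theorem RhoCondition.exists_almostMonotoneOn (h : RhoCondition q₀ q₁ b₀ b₁) :
    ∃ ε : ℝ, 0 < ε ∧ AlmostMonotoneOn (rhoEps ε q₀ q₁ b₀ b₁) (Ioi 0) :=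
  let ⟨ε, hε, _, hg, h⟩ := h
  ⟨ε, hε, .of_equivalent (fun _ hs _ ht hst => ENNReal.coe_le_coe.2 (hg hs ht hst)) h⟩

theorem RhoCondition.of_almostMonotoneOn (hq₀ : q₀ ≠ 0) (hq₁ : q₁ ≠ 0) (hb₀ : SVZero q₀ b₀)
    (hb₁ : SlowlyVarying b₁) {ε : ℝ} (hε : 0 < ε)
    (h : AlmostMonotoneOn (rhoEps ε q₀ q₁ b₀ b₁) (Ioi 0)) : RhoCondition q₀ q₁ b₀ b₁ := by
  refine ⟨ε, hε, h.exists_monotoneOn_equivalent fun t ht => ENNReal.div_ne_top ?_ ?_⟩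
  · exact ENNReal.rpow_ne_top_of_nonneg (by linarith) (hb₀.tailNorm_ne_top hq₀ ht)
  · exact hb₁.tailNorm_ne_zero hq₁ ht

theorem RhoCondition.exists_inv_tailNorm_le (hq₀ : q₀ ≠ 0) (hb₀ : SVZero q₀ b₀)
    (h : RhoCondition q₀ q₁ b₀ b₁) : ∃ ε : ℝ, 0 < ε ∧ ∃ M : ℝ≥0, ∀ s t, 0 < s → s ≤ t →
      (tailNorm q₁ b₁ s)⁻¹ ≤ M * (rho q₀ q₁ b₀ b₁ t * tailNorm q₀ b₀ t ^ ε) *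
        tailNorm q₀ b₀ s ^ (-(1 + ε)) := by
  obtain ⟨ε, hε, M, hM⟩ := h.exists_almostMonotoneOn
  refine ⟨ε, hε, M, fun s t hs hst => ?_⟩
  have hcancel : tailNorm q₀ b₀ s ^ (1 + ε) * tailNorm q₀ b₀ s ^ (-(1 + ε)) = 1 := by
    rw [← ENNReal.rpow_add _ _ (hb₀.1.tailNorm_ne_zero hq₀ hs) (hb₀.tailNorm_ne_top hq₀ hs),
      add_neg_cancel, ENNReal.rpow_zero]
  calc (tailNorm q₁ b₁ s)⁻¹
      = rhoEps ε q₀ q₁ b₀ b₁ s * tailNorm q₀ b₀ s ^ (-(1 + ε)) := by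
        rw [rhoEps, div_eq_mul_inv, mul_right_comm, hcancel, one_mul]
    _ ≤ M * (rho q₀ q₁ b₀ b₁ t * tailNorm q₀ b₀ t ^ ε) * tailNorm q₀ b₀ s ^ (-(1 + ε)) := by
        rw [← rhoEps_eq_rho_mul hq₀ hb₀ ε (hs.trans_le hst)]
        gcongr
        exact hM s hs t (mem_Ioi.2 (hs.trans_le hst)) hst

theorem RhoCondition.exists_mul_inv_tailNorm_le (hq₀ : q₀ ≠ 0) (hq₁ : q₁ ≠ 0)
    (hb₀ : SVZero q₀ b₀) (hb₁ : SVZero q₁ b₁) (h : RhoCondition q₀ q₁ b₀ b₁) :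
    ∃ p : ℝ, 0 < p ∧ ∃ M : ℝ≥0, ∀ t u, 0 < t → t ≤ u →
      rho q₀ q₁ b₀ b₁ t * tailNorm q₁ b₁ t ^ p * (tailNorm q₀ b₀ u)⁻¹ ≤
        M * tailNorm q₁ b₁ u ^ (p - 1) := by
  obtain ⟨ε, hε, hmono⟩ := h.exists_almostMonotoneOn
  obtain ⟨M, hM⟩ := hmono.rpow (p := (1 + ε)⁻¹) (by positivity)
  set p : ℝ := 1 - (1 + ε)⁻¹
  have hp : 0 < p := sub_pos.2 (inv_lt_one_of_one_lt₀ (by linarith))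
  refine ⟨p, hp, M, fun t u ht htu => ?_⟩
  have hu := ht.trans_le htu
  have h0 := hb₀.1.tailNorm_ne_zero hq₀ hu
  have htop := hb₀.tailNorm_ne_top hq₀ hu
  have hle := hM t ht u hu htu
  simp only [rhoEps_rpow_inv hq₁ hb₁ (by linarith : 0 < 1 + ε) ht,
    rhoEps_rpow_inv hq₁ hb₁ (by linarith : 0 < 1 + ε) hu, ENNReal.smul_def, smul_eq_mul] at hle
  calc rho q₀ q₁ b₀ b₁ t * tailNorm q₁ b₁ t ^ p * (tailNorm q₀ b₀ u)⁻¹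
      ≤ M * (rho q₀ q₁ b₀ b₁ u * tailNorm q₁ b₁ u ^ p) * (tailNorm q₀ b₀ u)⁻¹ := by gcongr
    _ = tailNorm q₀ b₀ u * (tailNorm q₀ b₀ u)⁻¹ *
          (M * (tailNorm q₁ b₁ u ^ p * (tailNorm q₁ b₁ u)⁻¹)) := by
        rw [rho, div_eq_mul_inv]; ring
    _ = M * tailNorm q₁ b₁ u ^ (p - 1) := by
        rw [ENNReal.mul_inv_cancel h0 htop, one_mul, ENNReal.rpow_sub p 1
          (hb₁.1.tailNorm_ne_zero hq₁ hu) (hb₁.tailNorm_ne_top hq₁ hu), ENNReal.rpow_one,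
          div_eq_mul_inv]

variable {𝕜 V : Type*} [RCLike 𝕜] [AddCommGroup V] [Module 𝕜 V] [TopologicalSpace V]
  (A₀ A₁ : QuasiNormedSubspace 𝕜 V)

theorem K_le_interpNorm_mul_inv {q : ℝ≥0∞} {b : ℝ → ℝ} (hq : q ≠ 0) (hb : SVZero q b) {f : V}
    (hf : f ∈ A₀.toSubmodule ⊔ A₁.toSubmodule) {u : ℝ} (hu : 0 < u) :
    K A₀ A₁ u f ≤ interpNorm A₀ A₁ 0 q b f * (tailNorm q b u)⁻¹ := by
  rw [← div_eq_mul_inv, ENNReal.le_div_iff_mul_le (.inl (hb.1.tailNorm_ne_zero hq hu))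
    (.inl (hb.tailNorm_ne_top hq hu))]
  exact (K_mul_tailNorm_le A₀ A₁ hf q b u).trans
    (weightedNorm_mono_set (Ioi_subset_Ioi hu.le) _)

theorem RhoCondition.exists_kNorm_Ioo_le (h : RhoCondition q₀ q₁ b₀ b₁) (hq₀ : q₀ ≠ 0)
    (hq₁ : q₁ ≠ 0) (hb₀ : SVZero q₀ b₀) (hb₁ : SVZero q₁ b₁) :
    ∃ C : ℝ≥0, ∀ f ∈ interpSpace A₀ A₁ 0 q₁ b₁, ∀ t : ℝ, 0 < t →
      kNorm A₀ A₁ 0 q₀ b₀ (Ioo 0 t) f ≤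
        C * (rho q₀ q₁ b₀ b₁ t * interpNorm A₀ A₁ 0 q₁ b₁ f) := by
  obtain ⟨ε, hε, M, hM⟩ := h.exists_inv_tailNorm_le hq₀ hb₀
  obtain ⟨C, hC⟩ := hb₀.exists_weightedNorm_Ioc_tailNorm_rpow_le hq₀ hε
  refine ⟨M * C, fun f hf t ht => ?_⟩
  set n := interpNorm A₀ A₁ 0 q₁ b₁ f
  set ρ := rho q₀ q₁ b₀ b₁ t
  have h0 := hb₀.1.tailNorm_ne_zero hq₀ ht
  have htop := hb₀.tailNorm_ne_top hq₀ ht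
  have hρ : ρ ≠ ∞ := rho_ne_top hq₀ hq₁ hb₀ hb₁.1 ht
  have hfin : n * (M * (ρ * tailNorm q₀ b₀ t ^ ε)) ≠ ∞ := ENNReal.mul_ne_top hf.2.ne
    (ENNReal.mul_ne_top ENNReal.coe_ne_top
      (ENNReal.mul_ne_top hρ (ENNReal.rpow_ne_top_of_nonneg hε.le htop)))
  calc kNorm A₀ A₁ 0 q₀ b₀ (Ioo 0 t) f
      ≤ n * (M * (ρ * tailNorm q₀ b₀ t ^ ε)) *
          weightedNorm q₀ b₀ (Ioo 0 t) (fun u => tailNorm q₀ b₀ u ^ (-(1 + ε))) := by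
        refine weightedNorm_le_mul hfin measurableSet_Ioo fun u hu => ?_
        rw [mul_assoc n]
        exact (K_le_interpNorm_mul_inv A₀ A₁ hq₁ hb₁ hf.1 hu.1).trans
          (mul_le_mul_right (hM u t hu.1 hu.2.le) _)
    _ ≤ n * (M * (ρ * tailNorm q₀ b₀ t ^ ε)) * (C * tailNorm q₀ b₀ t ^ (-ε)) := by
        rw [weightedNorm_Ioo_eq_Ioc]; gcongr; exact hC t ht
    _ = (M * C : ℝ≥0) * (ρ * n) * (tailNorm q₀ b₀ t ^ ε * tailNorm q₀ b₀ t ^ (-ε)) := by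
        push_cast; ring
    _ = (M * C : ℝ≥0) * (ρ * n) := by
        rw [← ENNReal.rpow_add _ _ h0 htop, add_neg_cancel, ENNReal.rpow_zero, mul_one]

theorem RhoCondition.exists_rho_mul_kNorm_Ioi_le (h : RhoCondition q₀ q₁ b₀ b₁) (hq₀ : q₀ ≠ 0)
    (hq₁ : q₁ ≠ 0) (hb₀ : SVZero q₀ b₀) (hb₁ : SVZero q₁ b₁) :
    ∃ C : ℝ≥0, ∀ f ∈ interpSpace A₀ A₁ 0 q₀ b₀, ∀ t : ℝ, 0 < t →
      rho q₀ q₁ b₀ b₁ t * kNorm A₀ A₁ 0 q₁ b₁ (Ioi t) f ≤ C * interpNorm A₀ A₁ 0 q₀ b₀ f := by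
  obtain ⟨p, hp, M, hM⟩ := h.exists_mul_inv_tailNorm_le hq₀ hq₁ hb₀ hb₁
  obtain ⟨C, hC⟩ := hb₁.exists_weightedNorm_Ioi_tailNorm_rpow_le hq₁ hp
  refine ⟨M * C, fun f hf t ht => ?_⟩
  set n := interpNorm A₀ A₁ 0 q₀ b₀ f
  set ρ := rho q₀ q₁ b₀ b₁ t
  set P := tailNorm q₁ b₁ t ^ p
  have htop := hb₁.tailNorm_ne_top hq₁ ht
  have hP0 : P ≠ 0 :=
    (ENNReal.rpow_pos (pos_iff_ne_zero.2 (hb₁.1.tailNorm_ne_zero hq₁ ht)) htop).ne'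
  have hPtop : P ≠ ∞ := ENNReal.rpow_ne_top_of_nonneg hp.le htop
  have hρ : ρ ≠ ∞ := rho_ne_top hq₀ hq₁ hb₀ hb₁.1 ht
  refine (ENNReal.mul_le_mul_iff_right hP0 hPtop).1 ?_
  calc P * (ρ * kNorm A₀ A₁ 0 q₁ b₁ (Ioi t) f)
      = ρ * P * kNorm A₀ A₁ 0 q₁ b₁ (Ioi t) f := by ring
    _ ≤ weightedNorm q₁ b₁ (Ioi t) (fun u => ρ * P * K A₀ A₁ u f) :=
        mul_weightedNorm_le (ENNReal.mul_ne_top hρ hPtop) measurableSet_Ioi fun _ _ => le_rfl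
    _ ≤ n * M * weightedNorm q₁ b₁ (Ioi t) (fun u => tailNorm q₁ b₁ u ^ (p - 1)) := by
        refine weightedNorm_le_mul (ENNReal.mul_ne_top hf.2.ne ENNReal.coe_ne_top)
          measurableSet_Ioi fun u hu => ?_
        calc ρ * P * K A₀ A₁ u f ≤ ρ * P * (n * (tailNorm q₀ b₀ u)⁻¹) := by
              gcongr; exact K_le_interpNorm_mul_inv A₀ A₁ hq₀ hb₀ hf.1 (ht.trans hu)
          _ = n * (ρ * P * (tailNorm q₀ b₀ u)⁻¹) := by ring
          _ ≤ n * M * tailNorm q₁ b₁ u ^ (p - 1) := by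
              rw [mul_assoc n]; exact mul_le_mul_right (hM t u ht (mem_Ioi.1 hu).le) _
    _ ≤ n * M * (C * P) := by gcongr; exact hC t ht
    _ = P * ((M * C : ℝ≥0) * n) := by push_cast; ring

theorem exists_kNorm_add_le (q : ℝ≥0∞) {b : ℝ → ℝ} (hb : SlowlyVarying b) : ∃ C : ℝ≥0,
    ∀ E : Set ℝ, MeasurableSet E → E ⊆ Ioi 0 → ∀ f g : V, kNorm A₀ A₁ 0 q b E (f + g) ≤
      C * (kNorm A₀ A₁ 0 q b E f + kNorm A₀ A₁ 0 q b E g) := by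
  obtain ⟨C, hC⟩ := exists_K_add_le A₀ A₁
  obtain ⟨D, hD⟩ := exists_weightedNorm_add_le q hb
  refine ⟨C * D, fun E hE hE0 f g => ?_⟩
  calc kNorm A₀ A₁ 0 q b E (f + g)
      ≤ C * weightedNorm q b E ((fun u => K A₀ A₁ u f) + fun u => K A₀ A₁ u g) :=
        weightedNorm_le_mul ENNReal.coe_ne_top hE fun u _ => hC u f g
    _ ≤ C * (D * (kNorm A₀ A₁ 0 q b E f + kNorm A₀ A₁ 0 q b E g)) := by
        gcongr
        exact hD E _ _ hE0 (K_mono A₀ A₁ f).measurable (K_mono A₀ A₁ g).measurable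
    _ = (C * D : ℝ≥0) * (kNorm A₀ A₁ 0 q b E f + kNorm A₀ A₁ 0 q b E g) := by push_cast; ring

theorem RhoCondition.exists_le_interpK (h : RhoCondition q₀ q₁ b₀ b₁) (hq₀ : q₀ ≠ 0)
    (hq₁ : q₁ ≠ 0) (hb₀ : SVZero q₀ b₀) (hb₁ : SVZero q₁ b₁) :
    ∃ C : ℝ≥0, ∀ (f : V) (t : ℝ), 0 < t →
      kNorm A₀ A₁ 0 q₀ b₀ (Ioo 0 t) f + rho q₀ q₁ b₀ b₁ t * kNorm A₀ A₁ 0 q₁ b₁ (Ioi t) f ≤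
        C * interpK A₀ A₁ q₀ q₁ b₀ b₁ (rho q₀ q₁ b₀ b₁ t) f := by
  obtain ⟨D₀, hD₀⟩ := exists_kNorm_add_le A₀ A₁ q₀ hb₀.1
  obtain ⟨D₁, hD₁⟩ := exists_kNorm_add_le A₀ A₁ q₁ hb₁.1
  obtain ⟨E₀, hE₀⟩ := h.exists_kNorm_Ioo_le A₀ A₁ hq₀ hq₁ hb₀ hb₁
  obtain ⟨E₁, hE₁⟩ := h.exists_rho_mul_kNorm_Ioi_le A₀ A₁ hq₀ hq₁ hb₀ hb₁
  refine ⟨D₀ * (1 + E₀) + D₁ * (1 + E₁) + 1, fun f t ht => ?_⟩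
  refine le_mul_kFunctional (by rw [ENNReal.coe_ne_zero]; positivity) ENNReal.coe_ne_top
    fun f₀ h₀ f₁ h₁ e => ?_
  set ρ := rho q₀ q₁ b₀ b₁ t
  set n₀ := interpNorm A₀ A₁ 0 q₀ b₀ f₀
  set n₁ := interpNorm A₀ A₁ 0 q₁ b₁ f₁
  have hI : kNorm A₀ A₁ 0 q₀ b₀ (Ioo 0 t) f ≤ D₀ * (n₀ + E₀ * (ρ * n₁)) := by
    rw [e]
    refine (hD₀ _ measurableSet_Ioo Ioo_subset_Ioi_self f₀ f₁).trans ?_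
    gcongr
    · exact weightedNorm_mono_set Ioo_subset_Ioi_self _
    · exact hE₀ f₁ h₁ t ht
  have hJ : ρ * kNorm A₀ A₁ 0 q₁ b₁ (Ioi t) f ≤ D₁ * (E₁ * n₀ + ρ * n₁) := by
    calc ρ * kNorm A₀ A₁ 0 q₁ b₁ (Ioi t) f
        ≤ ρ * (D₁ * (kNorm A₀ A₁ 0 q₁ b₁ (Ioi t) f₀ + n₁)) := by
          rw [e]
          refine mul_le_mul_right
            ((hD₁ _ measurableSet_Ioi (Ioi_subset_Ioi ht.le) f₀ f₁).trans ?_) _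
          gcongr
          exact weightedNorm_mono_set (Ioi_subset_Ioi ht.le) _
      _ = D₁ * (ρ * kNorm A₀ A₁ 0 q₁ b₁ (Ioi t) f₀ + ρ * n₁) := by ring
      _ ≤ D₁ * (E₁ * n₀ + ρ * n₁) := by gcongr D₁ * (?_ + _); exact hE₁ f₀ h₀ t ht
  calc kNorm A₀ A₁ 0 q₀ b₀ (Ioo 0 t) f + ρ * kNorm A₀ A₁ 0 q₁ b₁ (Ioi t) f
      ≤ D₀ * (n₀ + E₀ * (ρ * n₁)) + D₁ * (E₁ * n₀ + ρ * n₁) := by gcongr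
    _ ≤ D₀ * (n₀ + E₀ * (ρ * n₁)) + D₁ * (E₁ * n₀ + ρ * n₁) +
          ((D₀ * E₀ + D₁ + 1) * n₀ + (D₀ + D₁ * E₁ + 1) * (ρ * n₁)) := le_self_add
    _ = (D₀ * (1 + E₀) + D₁ * (1 + E₁) + 1 : ℝ≥0) * (n₀ + ρ * n₁) := by push_cast; ring

theorem RhoCondition.holmstedtFormula [IsTopologicalAddGroup V] [T2Space V]
    (h : RhoCondition q₀ q₁ b₀ b₁) (hq₀ : q₀ ≠ 0) (hq₁ : q₁ ≠ 0) (hb₀ : SVZero q₀ b₀)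
    (hb₁ : SVZero q₁ b₁) : HolmstedtFormula A₀ A₁ q₀ q₁ b₀ b₁ :=
  let ⟨_, hupper⟩ := exists_interpK_le A₀ A₁ hq₀ hq₁ hb₀.1 hb₁
  let ⟨_, hlower⟩ := h.exists_le_interpK A₀ A₁ hq₀ hq₁ hb₀ hb₁
  .of_le (fun p hp => hupper p.1 p.2 hp.1 hp.2) fun p hp => hlower p.1 p.2 hp.2

end RhoCondition

section GlidingHump

theorem eLpNorm_iSup_lt_top {α : Type*} {m : MeasurableSpace α} {μ : Measure α} {q c : ℝ≥0∞}
    (hq : q ≠ 0) (hc : c < 1) {f : ℕ → α → ℝ≥0∞} (hf : ∀ n, AEMeasurable (f n) μ)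
    (h : ∀ n, eLpNorm (f n) q μ ≤ c ^ n) : eLpNorm (fun x => ⨆ n, f n x) q μ < ∞ := by
  rcases eq_or_ne q ∞ with rfl | htop
  · refine lt_of_le_of_lt (eLpNormEssSup_le_of_ae_enorm_bound (C := 1) ?_) ENNReal.one_lt_top
    have hbound : ∀ n, ∀ᵐ x ∂μ, f n x ≤ 1 := fun n => by
      filter_upwards [ae_le_eLpNormEssSup (f := f n) (μ := μ)] with x hx
      exact hx.trans ((h n).trans (pow_le_one₀ zero_le hc.le))
    filter_upwards [ae_all_iff.2 hbound] with x hx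
    exact iSup_le hx
  · have hr := ENNReal.toReal_pos hq htop
    have hpow : ∀ n, ∫⁻ x, f n x ^ q.toReal ∂μ ≤ (c ^ q.toReal) ^ n := fun n => by
      have hn := h n
      rw [eLpNorm_eq_lintegral_rpow_enorm_toReal hq htop, one_div,
        ENNReal.rpow_inv_le_iff hr] at hn
      refine hn.trans_eq ?_
      rw [← ENNReal.rpow_natCast, ← ENNReal.rpow_natCast, ← ENNReal.rpow_mul, ← ENNReal.rpow_mul,
        mul_comm]
    refine (eLpNorm_lt_top_iff_lintegral_rpow_enorm_lt_top hq htop).2 ?_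
    have hsup : ∀ x, (⨆ n, f n x) ^ q.toReal = ⨆ n, f n x ^ q.toReal := fun x =>
      (ENNReal.orderIsoRpow q.toReal hr).map_iSup (f · x)
    calc ∫⁻ x, (⨆ n, f n x) ^ q.toReal ∂μ
        ≤ ∫⁻ x, ∑' n, f n x ^ q.toReal ∂μ := lintegral_mono fun x => by
          rw [hsup]
          exact iSup_le fun n => ENNReal.le_tsum n
      _ = ∑' n, ∫⁻ x, f n x ^ q.toReal ∂μ := lintegral_tsum fun n => (hf n).pow_const _
      _ ≤ ∑' n, (c ^ q.toReal) ^ n := ENNReal.tsum_le_tsum hpow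
      _ < ∞ := by
          rw [ENNReal.tsum_geometric, ENNReal.inv_lt_top]
          exact tsub_pos_of_lt (ENNReal.rpow_lt_one hc hr)

/-- The `ℝ≥0∞`-valued counterpart of `QuasiConcave`, in which the monotonicity of `t φ(1/t)` is
stated as that of `φ(t) / t`; this class is closed under finite suprema. -/
structure ExtQuasiConcave (φ : ℝ → ℝ≥0∞) : Prop where
  ne_zero : ∀ t, 0 < t → φ t ≠ 0
  ne_top : ∀ t, 0 < t → φ t ≠ ∞
  monotone : MonotoneOn φ (Ioi 0)
  mul_le : ∀ s t, 0 < s → s ≤ t → ENNReal.ofReal s * φ t ≤ ENNReal.ofReal t * φ s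

namespace ExtQuasiConcave

theorem quasiConcave_toReal {φ : ℝ → ℝ≥0∞} (h : ExtQuasiConcave φ) :
    QuasiConcave (fun t => (φ t).toReal) where
  pos t ht := ENNReal.toReal_pos (h.ne_zero t ht) (h.ne_top t ht)
  monotone s hs t ht hst := ENNReal.toReal_mono (h.ne_top t ht) (h.monotone hs ht hst)
  monotone_transpose s hs t ht hst := by
    have hs : 0 < s := hs
    have ht : 0 < t := ht
    have hle := ENNReal.toReal_mono
      (ENNReal.mul_ne_top ENNReal.ofReal_ne_top (h.ne_top _ (by positivity)))
      (h.mul_le (1 / t) (1 / s) (by positivity) (one_div_le_one_div_of_le hs hst))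
    rw [ENNReal.toReal_mul, ENNReal.toReal_mul, ENNReal.toReal_ofReal (by positivity),
      ENNReal.toReal_ofReal (by positivity)] at hle
    calc s * (φ (1 / s)).toReal = s * t * (1 / t * (φ (1 / s)).toReal) := by field_simp
      _ ≤ s * t * (1 / s * (φ (1 / t)).toReal) := by gcongr
      _ = t * (φ (1 / t)).toReal := by field_simp

theorem const_mul {φ : ℝ → ℝ≥0∞} (h : ExtQuasiConcave φ) {c : ℝ≥0∞} (hc : c ≠ 0)
    (hc' : c ≠ ∞) : ExtQuasiConcave (fun t => c * φ t) where
  ne_zero t ht := mul_ne_zero hc (h.ne_zero t ht)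
  ne_top t ht := ENNReal.mul_ne_top hc' (h.ne_top t ht)
  monotone _ hs _ ht hst := mul_le_mul_right (h.monotone hs ht hst) _
  mul_le s t hs hst := by
    rw [mul_left_comm, mul_left_comm (ENNReal.ofReal t)]
    exact mul_le_mul_right (h.mul_le s t hs hst) _

protected theorem iSup {ι : Type*} [Nonempty ι] {φ : ι → ℝ → ℝ≥0∞}
    (h : ∀ i, ExtQuasiConcave (φ i)) (htop : ∀ t, 0 < t → ⨆ i, φ i t ≠ ∞) :
    ExtQuasiConcave (fun t => ⨆ i, φ i t) where
  ne_zero t ht := by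
    obtain ⟨i⟩ := ‹Nonempty ι›
    exact ((pos_iff_ne_zero.2 ((h i).ne_zero t ht)).trans_le (le_iSup (φ · t) i)).ne'
  ne_top := htop
  monotone _ hs _ ht hst := iSup_mono fun i => (h i).monotone hs ht hst
  mul_le s t hs hst := by
    simp only [ENNReal.mul_iSup]
    exact iSup_mono fun i => (h i).mul_le s t hs hst

protected theorem aemeasurable {φ : ℝ → ℝ≥0∞} (h : ExtQuasiConcave φ) :
    AEMeasurable φ (volume.restrict (Ioi 0)) :=
  aemeasurable_restrict_of_monotoneOn measurableSet_Ioi h.monotone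

end ExtQuasiConcave

theorem extQuasiConcave_min (s : ℝ) :
    ExtQuasiConcave (fun u => min 1 (ENNReal.ofReal u / ENNReal.ofReal s)) where
  ne_zero u hu := (lt_min one_pos (ENNReal.div_pos (ENNReal.ofReal_pos.2 hu).ne'
    ENNReal.ofReal_ne_top)).ne'
  ne_top u _ := (min_le_left _ _).trans_lt ENNReal.one_lt_top |>.ne
  monotone u _ v _ huv := by
    dsimp only
    gcongr
  mul_le u v _ huv := by
    rw [mul_min, mul_min, mul_one, mul_one, ← mul_div_assoc, ← mul_div_assoc,
      mul_comm (ENNReal.ofReal u)]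
    exact min_le_min_right _ (ENNReal.ofReal_le_ofReal huv)

variable {q : ℝ≥0∞} {b : ℝ → ℝ} {φ : ℝ → ℝ≥0∞}

theorem ne_top_of_weightedNorm_ne_top (hq : q ≠ 0) (hb : SlowlyVarying b)
    (hφ : MonotoneOn φ (Ioi 0)) (h : weightedNorm q b (Ioi 0) φ ≠ ∞) {t : ℝ} (ht : 0 < t) :
    φ t ≠ ∞ := by
  intro htop
  obtain ⟨n, hn⟩ := ENNReal.exists_nat_mul_gt (hb.tailNorm_ne_zero hq ht) h
  refine hn.not_ge ((const_mul_tailNorm_le (ENNReal.natCast_ne_top n) fun u hu => ?_).trans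
    (weightedNorm_mono_set (Ioi_subset_Ioi ht.le) φ))
  have hle := hφ ht (ht.trans hu) (le_of_lt hu)
  rw [htop, top_le_iff] at hle
  simp only [hle, le_top]

theorem ExtQuasiConcave.weightedNorm_ne_zero (hφ : ExtQuasiConcave φ) (hq : q ≠ 0)
    (hb : SlowlyVarying b) : weightedNorm q b (Ioi 0) φ ≠ 0 := by
  have hle : φ 1 * tailNorm q b 1 ≤ weightedNorm q b (Ioi 0) φ :=
    (const_mul_tailNorm_le (hφ.ne_top 1 one_pos) fun u hu =>
      hφ.monotone (mem_Ioi.2 one_pos) (mem_Ioi.2 (one_pos.trans (mem_Ioi.1 hu)))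
        (le_of_lt hu)).trans
    (weightedNorm_mono_set (Ioi_subset_Ioi zero_le_one) φ)
  exact ((pos_iff_ne_zero.2 (mul_ne_zero (hφ.ne_zero 1 one_pos)
    (hb.tailNorm_ne_zero hq one_pos))).trans_le hle).ne'

theorem exists_extQuasiConcave_majorant_seq (hq : q ≠ 0) (hb : SlowlyVarying b)
    {φ : ℕ → ℝ → ℝ≥0∞} (hφ : ∀ n, ExtQuasiConcave (φ n))
    (hfin : ∀ n, weightedNorm q b (Ioi 0) (φ n) ≠ ∞) :
    ∃ Φ, ExtQuasiConcave Φ ∧ weightedNorm q b (Ioi 0) Φ ≠ ∞ ∧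
      ∀ n u, 2⁻¹ ^ n * (weightedNorm q b (Ioi 0) (φ n))⁻¹ * φ n u ≤ Φ u := by
  set w : ℕ → ℝ≥0∞ := fun n => 2⁻¹ ^ n * (weightedNorm q b (Ioi 0) (φ n))⁻¹
  have hnorm0 := fun n => (hφ n).weightedNorm_ne_zero hq hb
  have hw0 : ∀ n, w n ≠ 0 := fun n => mul_ne_zero (by simp) (ENNReal.inv_ne_zero.2 (hfin n))
  have hw : ∀ n, w n ≠ ∞ := fun n =>
    ENNReal.mul_ne_top (by finiteness) (ENNReal.inv_ne_top.2 (hnorm0 n))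
  have hscaled : ∀ n, weightedNorm q b (Ioi 0) (fun u => w n * φ n u) ≤ 2⁻¹ ^ n := fun n => by
    refine (weightedNorm_le_mul (hw n) measurableSet_Ioi fun _ _ => le_rfl).trans_eq ?_
    rw [mul_assoc, ENNReal.inv_mul_cancel (hnorm0 n) (hfin n), mul_one]
  have hΦ : weightedNorm q b (Ioi 0) (fun u => ⨆ n, w n * φ n u) ≠ ∞ := by
    simp only [weightedNorm, ENNReal.mul_iSup]
    exact (eLpNorm_iSup_lt_top hq (by simp : (2⁻¹ : ℝ≥0∞) < 1) (fun n =>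
      (hb.aemeasurable_weight subset_rfl).mul ((hφ n).aemeasurable.const_mul _)) hscaled).ne
  have hmono : MonotoneOn (fun u => ⨆ n, w n * φ n u) (Ioi 0) := fun _ hs _ ht hst =>
    iSup_mono fun n => mul_le_mul_right ((hφ n).monotone hs ht hst) _
  exact ⟨_, .iSup (fun n => (hφ n).const_mul (hw0 n) (hw n))
    fun t ht => ne_top_of_weightedNorm_ne_top hq hb hmono hΦ ht, hΦ,
    fun n u => le_iSup (fun n => w n * φ n u) n⟩

theorem exists_uniform_le_mul_weightedNorm {ι : Type*} (hq : q ≠ 0) (hb : SlowlyVarying b)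
    {L : ι → (ℝ → ℝ≥0∞) → ℝ≥0∞}
    (hL : ∀ i φ ψ, ∀ C ≠ ∞, (∀ u ∈ Ioi 0, C * φ u ≤ ψ u) → C * L i φ ≤ L i ψ)
    (h : ∀ φ, ExtQuasiConcave φ → weightedNorm q b (Ioi 0) φ ≠ ∞ →
      ∃ k : ℝ≥0, ∀ i, L i φ ≤ k * weightedNorm q b (Ioi 0) φ) :
    ∃ k : ℝ≥0, ∀ φ, ExtQuasiConcave φ → ∀ i, L i φ ≤ k * weightedNorm q b (Ioi 0) φ := by
  by_contra! hcon
  choose φ hφ i hlt using fun n : ℕ => hcon (4 ^ n)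
  have hfin : ∀ n, weightedNorm q b (Ioi 0) (φ n) ≠ ∞ := fun n htop => by
    have hn := hlt n
    rw [htop, ENNReal.mul_top (by simp)] at hn
    exact not_top_lt hn
  obtain ⟨Φ, hΦ, hΦfin, hle⟩ := exists_extQuasiConcave_majorant_seq hq hb hφ hfin
  obtain ⟨k, hk⟩ := h Φ hΦ hΦfin
  obtain ⟨n, hn⟩ := ENNReal.exists_nat_gt
    (ENNReal.mul_ne_top (ENNReal.coe_ne_top (r := k)) hΦfin)
  set m := weightedNorm q b (Ioi 0) (φ n)
  have hm : m ≠ 0 := (hφ n).weightedNorm_ne_zero hq hb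
  have hgrowth : (2 : ℝ≥0∞) ^ n ≤ k * weightedNorm q b (Ioi 0) Φ := by
    calc (2 : ℝ≥0∞) ^ n = 2 ^ n * (2⁻¹ ^ n * 2 ^ n) * (m⁻¹ * m) := by
          rw [ENNReal.inv_mul_cancel hm (hfin n), ← mul_pow,
            ENNReal.inv_mul_cancel two_ne_zero (by simp), one_pow, mul_one, mul_one]
      _ = 2⁻¹ ^ n * m⁻¹ * ((4 ^ n : ℝ≥0) * m) := by
          rw [show (4 ^ n : ℝ≥0) = 2 ^ n * 2 ^ n by rw [← mul_pow]; norm_num]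
          push_cast
          ring
      _ ≤ 2⁻¹ ^ n * m⁻¹ * L (i n) (φ n) := by gcongr; exact (hlt n).le
      _ ≤ L (i n) Φ := hL _ _ _ _ (ENNReal.mul_ne_top (by finiteness) (ENNReal.inv_ne_top.2 hm))
          fun u _ => hle n u
      _ ≤ k * weightedNorm q b (Ioi 0) Φ := hk _
  exact absurd (hgrowth.trans_lt hn) (not_lt.2 (by exact_mod_cast n.lt_two_pow_self.le))

end GlidingHump

section TestFunctions

variable {q : ℝ≥0∞} {b : ℝ → ℝ}

theorem SlowlyVarying.exists_weightedNorm_min_le (hb : SlowlyVarying b) (hq : q ≠ 0) :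
    ∃ C : ℝ≥0, ∀ s, 0 < s →
      weightedNorm q b (Ioi 0) (fun u => min 1 (ENNReal.ofReal u / ENNReal.ofReal s)) ≤
        C * tailNorm q b s := by
  obtain ⟨D, hD⟩ := exists_weightedNorm_union_le q b
  obtain ⟨E, hE⟩ := hb.exists_weightedNorm_id_le_tailNorm hq
  refine ⟨D * (E + 1), fun s hs => ?_⟩
  set φ : ℝ → ℝ≥0∞ := fun u => min 1 (ENNReal.ofReal u / ENNReal.ofReal s)
  have hs0 : ENNReal.ofReal s ≠ 0 := (ENNReal.ofReal_pos.2 hs).ne'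
  have hleft : weightedNorm q b (Ioc 0 s) φ ≤ E * tailNorm q b s := by
    calc weightedNorm q b (Ioc 0 s) φ
        ≤ (ENNReal.ofReal s)⁻¹ * weightedNorm q b (Ioc 0 s) ENNReal.ofReal :=
          weightedNorm_le_mul (ENNReal.inv_ne_top.2 hs0) measurableSet_Ioc fun u _ =>
            (min_le_right _ _).trans_eq (by rw [div_eq_mul_inv, mul_comm])
      _ ≤ (ENNReal.ofReal s)⁻¹ * (E * (ENNReal.ofReal s * tailNorm q b s)) := by
          gcongr; exact hE s hs
      _ = ((ENNReal.ofReal s)⁻¹ * ENNReal.ofReal s) * (E * tailNorm q b s) := by ring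
      _ = E * tailNorm q b s := by rw [ENNReal.inv_mul_cancel hs0 ENNReal.ofReal_ne_top, one_mul]
  have hright : weightedNorm q b (Ioi s) φ ≤ 1 * tailNorm q b s :=
    weightedNorm_const_Ioi_le ENNReal.one_ne_top fun u _ => min_le_left _ _
  calc weightedNorm q b (Ioi 0) φ
      ≤ D * (weightedNorm q b (Ioc 0 s) φ + weightedNorm q b (Ioi s) φ) := by
        rw [← Ioc_union_Ioi_eq_Ioi hs.le]; exact hD _ _ _
    _ ≤ D * (E * tailNorm q b s + 1 * tailNorm q b s) := by gcongr
    _ = (D * (E + 1) : ℝ≥0) * tailNorm q b s := by push_cast; ring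

/-- The least function `φ` with `φ` and `t φ(1/t)` non-decreasing that dominates `1 / T` on
`[a, t]`, where `T` is the tail norm. It is the test function on which a Hardy inequality
compares `‖1 / T‖` for two different exponents. -/
def tailInvMajorant (q : ℝ≥0∞) (b : ℝ → ℝ) (a t u : ℝ) : ℝ≥0∞ :=
  ⨆ s : Icc a t, (tailNorm q b s)⁻¹ * min 1 (ENNReal.ofReal u / ENNReal.ofReal s)

theorem tailInvMajorant_le (a t u : ℝ) : tailInvMajorant q b a t u ≤ (tailNorm q b t)⁻¹ :=
  iSup_le fun s => (mul_le_of_le_one_right' (min_le_left _ _)).trans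
    (ENNReal.inv_le_inv.2 (tailNorm_antitone s.2.2))

theorem inv_tailNorm_le_tailInvMajorant {a t u : ℝ} (ha : 0 < a) (hu : u ∈ Icc a t) :
    (tailNorm q b u)⁻¹ ≤ tailInvMajorant q b a t u := by
  refine le_iSup_of_le ⟨u, hu⟩ ?_
  rw [ENNReal.div_self (ENNReal.ofReal_pos.2 (ha.trans_le hu.1)).ne' ENNReal.ofReal_ne_top,
    min_self, mul_one]

theorem SVZero.extQuasiConcave_tailInvMajorant (hb : SVZero q b) (hq : q ≠ 0) {a t : ℝ}
    (ha : 0 < a) (hat : a ≤ t) : ExtQuasiConcave (tailInvMajorant q b a t) := by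
  have : Nonempty (Icc a t) := ⟨⟨a, le_rfl, hat⟩⟩
  refine .iSup (fun s => ?_) fun u _ => ne_top_of_le_ne_top
    (ENNReal.inv_ne_top.2 (hb.1.tailNorm_ne_zero hq (ha.trans_le hat))) (tailInvMajorant_le a t u)
  have hs : 0 < (s : ℝ) := ha.trans_le s.2.1
  exact (extQuasiConcave_min s).const_mul (ENNReal.inv_ne_zero.2 (hb.tailNorm_ne_top hq hs))
    (ENNReal.inv_ne_top.2 (hb.1.tailNorm_ne_zero hq hs))

theorem SVZero.exists_inv_tailNorm_mul_min_le (hb : SVZero q b) (hq : q ≠ 0) :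
    ∃ M : ℝ≥0, ∀ r s u, 0 < r → r ≤ s →
      (tailNorm q b s)⁻¹ * min 1 (ENNReal.ofReal u / ENNReal.ofReal s) ≤
        M * (ENNReal.ofReal r * tailNorm q b r)⁻¹ * ENNReal.ofReal u := by
  obtain ⟨M, hM⟩ := hb.1.almostMonotoneOn_mul_tailNorm hq
  simp only [ENNReal.smul_def, smul_eq_mul] at hM
  refine ⟨M, fun r s u hr hrs => ?_⟩
  have hs := hr.trans_le hrs
  have hne : ∀ v, 0 < v → ENNReal.ofReal v * tailNorm q b v ≠ 0 := fun v hv =>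
    mul_ne_zero (ENNReal.ofReal_pos.2 hv).ne' (hb.1.tailNorm_ne_zero hq hv)
  have htop : ∀ v, 0 < v → ENNReal.ofReal v * tailNorm q b v ≠ ∞ := fun v hv =>
    ENNReal.mul_ne_top ENNReal.ofReal_ne_top (hb.tailNorm_ne_top hq hv)
  have hinv : (ENNReal.ofReal s * tailNorm q b s)⁻¹ ≤
      M * (ENNReal.ofReal r * tailNorm q b r)⁻¹ :=
    inv_le_mul_inv_of_le_mul (hne r hr) (htop r hr) (hne s hs) (htop s hs) (hM r hr s hs hrs)
  calc (tailNorm q b s)⁻¹ * min 1 (ENNReal.ofReal u / ENNReal.ofReal s)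
      ≤ (tailNorm q b s)⁻¹ * (ENNReal.ofReal u / ENNReal.ofReal s) := by
        gcongr; exact min_le_right _ _
    _ = (ENNReal.ofReal s * tailNorm q b s)⁻¹ * ENNReal.ofReal u := by
        rw [ENNReal.mul_inv (.inr (hb.tailNorm_ne_top hq hs)) (.inl ENNReal.ofReal_ne_top),
          div_eq_mul_inv]
        ring
    _ ≤ M * (ENNReal.ofReal r * tailNorm q b r)⁻¹ * ENNReal.ofReal u := by gcongr

theorem SVZero.exists_tailInvMajorant_le (hb : SVZero q b) (hq : q ≠ 0) :
    ∃ M : ℝ≥0, ∀ a t, 0 < a →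
      (∀ u, tailInvMajorant q b a t u ≤
        M * (ENNReal.ofReal a * tailNorm q b a)⁻¹ * ENNReal.ofReal u) ∧
      ∀ u, a ≤ u → tailInvMajorant q b a t u ≤ M * (tailNorm q b u)⁻¹ := by
  obtain ⟨M, hM⟩ := hb.exists_inv_tailNorm_mul_min_le hq
  refine ⟨max 1 M, fun a t ha => ⟨fun u => iSup_le fun s => ?_, fun u hau => iSup_le fun s => ?_⟩⟩
  · exact (hM a s u ha s.2.1).trans (by gcongr; exact le_max_right 1 M)
  · have hu := ha.trans_le hau
    rcases le_total (s : ℝ) u with hsu | hus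
    · calc (tailNorm q b s)⁻¹ * min 1 (ENNReal.ofReal u / ENNReal.ofReal s)
          ≤ 1 * (tailNorm q b u)⁻¹ := by
            rw [one_mul]
            exact (mul_le_of_le_one_right' (min_le_left _ _)).trans
              (ENNReal.inv_le_inv.2 (tailNorm_antitone hsu))
        _ ≤ (max 1 M : ℝ≥0) * (tailNorm q b u)⁻¹ := by
            gcongr; exact_mod_cast le_max_left 1 M
    · calc (tailNorm q b s)⁻¹ * min 1 (ENNReal.ofReal u / ENNReal.ofReal s)
          ≤ M * (ENNReal.ofReal u * tailNorm q b u)⁻¹ * ENNReal.ofReal u := hM u s u hu hus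
        _ = M * (tailNorm q b u)⁻¹ * ((ENNReal.ofReal u)⁻¹ * ENNReal.ofReal u) := by
            rw [ENNReal.mul_inv (.inr (hb.tailNorm_ne_top hq hu)) (.inl ENNReal.ofReal_ne_top)]
            ring
        _ = M * (tailNorm q b u)⁻¹ := by
            rw [ENNReal.inv_mul_cancel (ENNReal.ofReal_pos.2 hu).ne' ENNReal.ofReal_ne_top, mul_one]
        _ ≤ (max 1 M : ℝ≥0) * (tailNorm q b u)⁻¹ := by gcongr; exact le_max_right 1 M

theorem SVZero.exists_weightedNorm_tailInvMajorant_le (hb : SVZero q b) (hq : q ≠ 0) :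
    ∃ C : ℝ≥0, ∀ a t, 0 < a → a ≤ t →
      weightedNorm q b (Ioi 0) (tailInvMajorant q b a t) ≤
        C * (1 + weightedNorm q b (Ioc a t) (fun u => (tailNorm q b u)⁻¹)) := by
  obtain ⟨M, hM⟩ := hb.exists_tailInvMajorant_le hq
  obtain ⟨D, hD⟩ := exists_weightedNorm_union_le q b
  obtain ⟨E, hE⟩ := hb.1.exists_weightedNorm_id_le_tailNorm hq
  refine ⟨D * (M * E + D * (M + 1)), fun a t ha hat => ?_⟩
  obtain ⟨hnear, hmid⟩ := hM a t ha
  have ht := ha.trans_le hat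
  set Φ := tailInvMajorant q b a t
  set L := weightedNorm q b (Ioc a t) (fun u => (tailNorm q b u)⁻¹)
  have hne : ENNReal.ofReal a * tailNorm q b a ≠ 0 :=
    mul_ne_zero (ENNReal.ofReal_pos.2 ha).ne' (hb.1.tailNorm_ne_zero hq ha)
  have htop : ENNReal.ofReal a * tailNorm q b a ≠ ∞ :=
    ENNReal.mul_ne_top ENNReal.ofReal_ne_top (hb.tailNorm_ne_top hq ha)
  have h₁ : weightedNorm q b (Ioc 0 a) Φ ≤ M * E := by
    calc weightedNorm q b (Ioc 0 a) Φ
        ≤ M * (ENNReal.ofReal a * tailNorm q b a)⁻¹ *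
            weightedNorm q b (Ioc 0 a) ENNReal.ofReal :=
          weightedNorm_le_mul (ENNReal.mul_ne_top ENNReal.coe_ne_top (ENNReal.inv_ne_top.2 hne))
            measurableSet_Ioc fun u _ => hnear u
      _ ≤ M * (ENNReal.ofReal a * tailNorm q b a)⁻¹ *
            (E * (ENNReal.ofReal a * tailNorm q b a)) := by gcongr; exact hE a ha
      _ = M * E * ((ENNReal.ofReal a * tailNorm q b a)⁻¹ *
            (ENNReal.ofReal a * tailNorm q b a)) := by ring
      _ = M * E := by rw [ENNReal.inv_mul_cancel hne htop, mul_one]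
  have h₂ : weightedNorm q b (Ioc a t) Φ ≤ M * L :=
    weightedNorm_le_mul ENNReal.coe_ne_top measurableSet_Ioc fun u hu => hmid u hu.1.le
  have h₃ : weightedNorm q b (Ioi t) Φ ≤ 1 :=
    (weightedNorm_const_Ioi_le (ENNReal.inv_ne_top.2 (hb.1.tailNorm_ne_zero hq ht))
      fun u _ => tailInvMajorant_le a t u).trans_eq
      (ENNReal.inv_mul_cancel (hb.1.tailNorm_ne_zero hq ht) (hb.tailNorm_ne_top hq ht))
  calc weightedNorm q b (Ioi 0) Φ
      ≤ D * (weightedNorm q b (Ioc 0 a) Φ +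
          D * (weightedNorm q b (Ioc a t) Φ + weightedNorm q b (Ioi t) Φ)) := by
        rw [← Ioc_union_Ioi_eq_Ioi ha.le, ← Ioc_union_Ioi_eq_Ioi hat]
        exact (hD _ _ _).trans (by gcongr; exact hD _ _ _)
    _ ≤ D * (M * E + D * (M * L + 1)) := by gcongr
    _ ≤ D * (M * E + D * (M * L + 1)) + D * (M * E * L + D * (M + L)) := le_self_add
    _ = (D * (M * E + D * (M + 1)) : ℝ≥0) * (1 + L) := by push_cast; ring

theorem SVZero.exists_weightedNorm_Ioc_tailNorm_inv_le (hb : SVZero q b) (hq : q ≠ 0) :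
    ∃ C : ℝ≥0, ∀ a t, 0 < a → a ≤ t → ∀ y : ℝ, 1 ≤ y →
      Real.log ((tailNorm q b a).toReal / (tailNorm q b t).toReal) ≤ y →
        weightedNorm q b (Ioc a t) (fun u => (tailNorm q b u)⁻¹) ≤
          C * ENNReal.ofReal (y ^ q⁻¹.toReal) := by
  rcases eq_or_ne q ∞ with rfl | htop
  · obtain ⟨C, hC⟩ := hb.exists_weightedNorm_top_tailNorm_rpow_le
    refine ⟨C, fun a t ha _ y _ _ => ?_⟩
    have h := hC (Ioc a t) (-1) 1 measurableSet_Ioc (fun u hu => ha.trans hu.1) (by simp)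
    simpa [ENNReal.rpow_neg_one] using h
  · have hr := ENNReal.toReal_pos hq htop
    refine ⟨q.toReal.toNNReal ^ (1 / q.toReal), fun a t ha hat y hy hle => ?_⟩
    rw [hb.weightedNorm_Ioc_tailNorm_inv hq htop ha hat]
    calc _ ≤ ENNReal.ofReal (q.toReal * y) ^ (1 / q.toReal) := by gcongr
      _ = _ := by
        rw [ENNReal.ofReal_mul hr.le, ENNReal.mul_rpow_of_nonneg _ _ (by positivity),
          ENNReal.coe_rpow_of_nonneg _ (by positivity),
          ENNReal.ofReal_rpow_of_pos (x := y) (by linarith), ENNReal.toReal_inv, one_div]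
        rfl

end TestFunctions

section HardyComparison

theorem le_rpow_inv_of_mul_rpow_le {κ B α β x : ℝ} (hκ : 0 < κ) (hαβ : β < α) (hx : 0 < x)
    (h : κ * x ^ α ≤ B * x ^ β) : x ≤ (B / κ) ^ (α - β)⁻¹ := by
  have hpow : x ^ (α - β) ≤ B / κ := by
    rw [Real.rpow_sub hx, div_le_div_iff₀ (Real.rpow_pos_of_pos hx _) hκ]
    linarith
  have hB : 0 ≤ B / κ := (Real.rpow_nonneg hx.le _).trans hpow
  exact (Real.le_rpow_inv_iff_of_pos hx.le hB (sub_pos.2 hαβ)).2 hpow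

variable {p q : ℝ≥0∞} {v w : ℝ → ℝ} {A : ℝ≥0} {a c t : ℝ}

theorem log_tailNorm_div_le_of_rho_le (hp : p ≠ 0) (hq : q ≠ 0) (hv : SVZero p v)
    (hw : SVZero q w) (ha : 0 < a) (ht : 0 < t) (h : rho q p w v a ≤ A * rho q p w v t) :
    Real.log ((tailNorm q w a).toReal / (tailNorm q w t).toReal) ≤
      Real.log A + Real.log ((tailNorm p v a).toReal / (tailNorm p v t).toReal) := by
  have hSa := hv.toReal_tailNorm_pos hp ha
  have hSt := hv.toReal_tailNorm_pos hp ht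
  have hTa := hw.toReal_tailNorm_pos hq ha
  have hTt := hw.toReal_tailNorm_pos hq ht
  have hle := ENNReal.toReal_mono
    (ENNReal.mul_ne_top ENNReal.coe_ne_top (rho_ne_top hq hp hw hv.1 ht)) h
  simp only [rho, ENNReal.toReal_mul, ENNReal.toReal_div, ENNReal.coe_toReal] at hle
  have hA : (0 : ℝ) < A := pos_of_mul_pos_left ((div_pos hTa hSa).trans_le hle) (by positivity)
  rw [← Real.log_mul hA.ne' (by positivity)]
  refine Real.log_le_log (by positivity) ?_
  rw [div_le_iff₀ hTt]
  rw [div_le_iff₀ hSa] at hle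
  exact hle.trans_eq (by ring)

theorem exists_weightedNorm_inv_tailNorm_le_of_hardy (hp : p ≠ 0) (hq : q ≠ 0) (hv : SVZero p v)
    (hw : SVZero q w) (A k : ℝ≥0) :
    ∃ C : ℝ≥0, ∀ a c t, 0 < a → c ∈ Icc a t →
      (∀ u ∈ Icc a t, rho q p w v u ≤ A * rho q p w v c) →
      (∀ φ, ExtQuasiConcave φ →
        rho q p w v c * weightedNorm p v (Ioc a t) φ ≤ k * weightedNorm q w (Ioi 0) φ) →
      weightedNorm p v (Ioc a t) (fun u => (tailNorm p v u)⁻¹) ≤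
        C * (1 + weightedNorm q w (Ioc a t) (fun u => (tailNorm q w u)⁻¹)) := by
  obtain ⟨C, hC⟩ := hw.exists_weightedNorm_tailInvMajorant_le hq
  refine ⟨A * (k * C), fun a c t ha hc hrho hardy => ?_⟩
  have hat := hc.1.trans hc.2
  set Φ := tailInvMajorant q w a t
  set L := weightedNorm q w (Ioc a t) (fun u => (tailNorm q w u)⁻¹)
  have hinv : ∀ u ∈ Ioc a t, (tailNorm p v u)⁻¹ ≤ A * rho q p w v c * Φ u := fun u hu => by
    have hu0 := ha.trans hu.1
    have huI : u ∈ Icc a t := ⟨hu.1.le, hu.2⟩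
    calc (tailNorm p v u)⁻¹ = rho q p w v u * (tailNorm q w u)⁻¹ := by
          rw [rho, div_eq_mul_inv, mul_right_comm, ENNReal.mul_inv_cancel
            (hw.1.tailNorm_ne_zero hq hu0) (hw.tailNorm_ne_top hq hu0), one_mul]
      _ ≤ A * rho q p w v c * Φ u :=
          mul_le_mul' (hrho u huI) (inv_tailNorm_le_tailInvMajorant ha huI)
  calc weightedNorm p v (Ioc a t) (fun u => (tailNorm p v u)⁻¹)
      ≤ A * rho q p w v c * weightedNorm p v (Ioc a t) Φ :=
        weightedNorm_le_mul (ENNReal.mul_ne_top ENNReal.coe_ne_top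
          (rho_ne_top hq hp hw hv.1 (ha.trans_le hc.1))) measurableSet_Ioc hinv
    _ = A * (rho q p w v c * weightedNorm p v (Ioc a t) Φ) := mul_assoc _ _ _
    _ ≤ A * (k * weightedNorm q w (Ioi 0) Φ) := by
        exact mul_le_mul_right (hardy Φ (hw.extQuasiConcave_tailInvMajorant hq ha hat)) _
    _ ≤ A * (k * (C * (1 + L))) := by gcongr; exact hC a t ha hat
    _ = (A * (k * C) : ℝ≥0) * (1 + L) := by push_cast; ring

theorem exists_log_tailNorm_div_le_of_weightedNorm_le (hpq : p < q) (hp : p ≠ 0)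
    (hv : SVZero p v) (hw : SVZero q w) (C : ℝ≥0) (d : ℝ) :
    ∃ X : ℝ, ∀ a t, 0 < a → a ≤ t →
      weightedNorm p v (Ioc a t) (fun u => (tailNorm p v u)⁻¹) ≤
        C * (1 + weightedNorm q w (Ioc a t) (fun u => (tailNorm q w u)⁻¹)) →
      Real.log ((tailNorm q w a).toReal / (tailNorm q w t).toReal) ≤
        d + Real.log ((tailNorm p v a).toReal / (tailNorm p v t).toReal) →
      Real.log ((tailNorm p v a).toReal / (tailNorm p v t).toReal) ≤ X := by
  have hq : q ≠ 0 := (zero_le.trans_lt hpq).ne'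
  have hr := ENNReal.toReal_pos hp hpq.ne_top
  obtain ⟨D, hD⟩ := hw.exists_weightedNorm_Ioc_tailNorm_inv_le hq
  set α := p⁻¹.toReal
  set β := q⁻¹.toReal
  have hβ : 0 ≤ β := ENNReal.toReal_nonneg
  have hβα : β < α := ENNReal.toReal_strict_mono (ENNReal.inv_ne_top.2 hp)
    (ENNReal.inv_lt_inv.2 hpq)
  set B : ℝ := C * (1 + D * (1 + |d|) ^ β)
  refine ⟨max 1 ((B / p.toReal ^ α) ^ (α - β)⁻¹), fun a t ha hat hle hlog => ?_⟩
  set x := Real.log ((tailNorm p v a).toReal / (tailNorm p v t).toReal)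
  rcases le_or_gt x 1 with hx | hx
  · exact hx.trans (le_max_left _ _)
  have hx0 : 0 < x := one_pos.trans hx
  have hy : d + x ≤ (1 + |d|) * x := by nlinarith [le_abs_self d, abs_nonneg d]
  have hL := hD a t ha hat _ (by nlinarith [abs_nonneg d]) (hlog.trans hy)
  have hxβ : 1 ≤ x ^ β := Real.one_le_rpow hx.le hβ
  have hreal : p.toReal ^ α * x ^ α ≤ B * x ^ β := by
    rw [← ENNReal.ofReal_le_ofReal_iff (by positivity), ← Real.mul_rpow hr.le hx0.le,
      ← ENNReal.ofReal_rpow_of_pos (by positivity)]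
    calc ENNReal.ofReal (p.toReal * x) ^ α
        = weightedNorm p v (Ioc a t) (fun u => (tailNorm p v u)⁻¹) := by
          rw [hv.weightedNorm_Ioc_tailNorm_inv hp hpq.ne_top ha hat, one_div, ← ENNReal.toReal_inv]
      _ ≤ C * (1 + D * ENNReal.ofReal (((1 + |d|) * x) ^ β)) := hle.trans (by gcongr)
      _ = ENNReal.ofReal (C * (1 + D * ((1 + |d|) * x) ^ β)) := by
          rw [ENNReal.ofReal_mul C.coe_nonneg, ENNReal.ofReal_add zero_le_one (by positivity),
            ENNReal.ofReal_mul D.coe_nonneg, ENNReal.ofReal_one, ENNReal.ofReal_coe_nnreal,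
            ENNReal.ofReal_coe_nnreal]
      _ ≤ ENNReal.ofReal (B * x ^ β) := ENNReal.ofReal_le_ofReal <| by
          rw [Real.mul_rpow (by positivity) hx0.le, mul_assoc, add_mul, mul_assoc, one_mul]
          gcongr
  exact (le_rpow_inv_of_mul_rpow_le (by positivity) hβα hx0 hreal).trans (le_max_right _ _)

theorem exists_log_tailNorm_div_le_of_hardy (hpq : p < q) (hp : p ≠ 0) (hv : SVZero p v)
    (hw : SVZero q w) (A k : ℝ≥0) :
    ∃ X : ℝ, ∀ a c t, 0 < a → c ∈ Icc a t →
      (∀ u ∈ Icc a t, ∀ u' ∈ Icc a t, rho q p w v u ≤ A * rho q p w v u') →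
      (∀ φ, ExtQuasiConcave φ →
        rho q p w v c * weightedNorm p v (Ioc a t) φ ≤ k * weightedNorm q w (Ioi 0) φ) →
      Real.log ((tailNorm p v a).toReal / (tailNorm p v t).toReal) ≤ X := by
  have hq : q ≠ 0 := (zero_le.trans_lt hpq).ne'
  obtain ⟨C, hC⟩ := exists_weightedNorm_inv_tailNorm_le_of_hardy hp hq hv hw A k
  obtain ⟨X, hX⟩ := exists_log_tailNorm_div_le_of_weightedNorm_le hpq hp hv hw C (Real.log A)
  refine ⟨X, fun a c t ha hc hrho hardy => ?_⟩
  have hat := hc.1.trans hc.2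
  exact hX a t ha hat (hC a c t ha hc (fun u hu => hrho u hu c hc) hardy)
    (log_tailNorm_div_le_of_rho_le hp hq hv hw ha (ha.trans_le hat)
      (hrho a ⟨le_rfl, hat⟩ t ⟨hat, le_rfl⟩))

end HardyComparison

section FromFormula

variable {𝕜 V : Type*} [RCLike 𝕜] [AddCommGroup V] [Module 𝕜 V] [TopologicalSpace V]
  {A₀ A₁ : QuasiNormedSubspace 𝕜 V} {q₀ q₁ : ℝ≥0∞} {b₀ b₁ : ℝ → ℝ}

theorem rho_swap (hq₀ : q₀ ≠ 0) (hq₁ : q₁ ≠ 0) (hb₀ : SlowlyVarying b₀) (hb₁ : SVZero q₁ b₁)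
    {t : ℝ} (ht : 0 < t) : rho q₁ q₀ b₁ b₀ t = (rho q₀ q₁ b₀ b₁ t)⁻¹ :=
  (ENNReal.inv_div (.inl (hb₁.tailNorm_ne_top hq₁ ht))
    (.inr (hb₀.tailNorm_ne_zero hq₀ ht))).symm

theorem zero_mem_interpSpace (A₀ A₁ : QuasiNormedSubspace 𝕜 V) (q : ℝ≥0∞) (b : ℝ → ℝ) :
    0 ∈ interpSpace A₀ A₁ 0 q b ∧ interpNorm A₀ A₁ 0 q b 0 = 0 := by
  have hK : ∀ u, K A₀ A₁ u 0 = 0 := fun u => by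
    simpa [A₀.qnorm_zero] using K_le_qnorm_left A₀ A₁ A₀.toSubmodule.zero_mem u
  have hnorm : interpNorm A₀ A₁ 0 q b 0 = 0 := by
    simp only [interpNorm, kNorm, hK, mul_zero]
    exact eLpNorm_zero'
  exact ⟨⟨zero_mem _, hnorm ▸ ENNReal.zero_lt_top⟩, hnorm⟩

theorem interpK_le_interpNorm_left {f : V} (hf : f ∈ interpSpace A₀ A₁ 0 q₀ b₀) (s : ℝ≥0∞) :
    interpK A₀ A₁ q₀ q₁ b₀ b₁ s f ≤ interpNorm A₀ A₁ 0 q₀ b₀ f := by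
  obtain ⟨hmem, hzero⟩ := zero_mem_interpSpace A₀ A₁ q₁ b₁
  refine (kFunctional_le hf hmem (add_zero f).symm).trans_eq ?_
  rw [hzero, mul_zero, add_zero]

theorem interpK_le_mul_interpNorm_right {f : V} (hf : f ∈ interpSpace A₀ A₁ 0 q₁ b₁)
    (s : ℝ≥0∞) : interpK A₀ A₁ q₀ q₁ b₀ b₁ s f ≤ s * interpNorm A₀ A₁ 0 q₁ b₁ f := by
  obtain ⟨hmem, hzero⟩ := zero_mem_interpSpace A₀ A₁ q₀ b₀
  refine (kFunctional_le hmem hf (zero_add f).symm).trans_eq ?_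
  rw [hzero, zero_add]

theorem HolmstedtFormula.exists_le_mul_interpK (hH : HolmstedtFormula A₀ A₁ q₀ q₁ b₀ b₁) :
    ∃ c : ℝ≥0, ∀ f ∈ A₀.toSubmodule ⊔ A₁.toSubmodule, ∀ t, 0 < t →
      kNorm A₀ A₁ 0 q₀ b₀ (Ioo 0 t) f + rho q₀ q₁ b₀ b₁ t * kNorm A₀ A₁ 0 q₁ b₁ (Ioi t) f ≤
        c * interpK A₀ A₁ q₀ q₁ b₀ b₁ (rho q₀ q₁ b₀ b₁ t) f := by
  obtain ⟨c, -, hc⟩ := hH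
  exact ⟨c, fun f hf t ht => (hc (f, t) ⟨hf, ht⟩).2⟩

theorem KSurjective.exists_kNorm_equiv (hs : KSurjective A₀ A₁) {φ : ℝ → ℝ≥0∞}
    (hφ : ExtQuasiConcave φ) :
    ∃ f ∈ A₀.toSubmodule ⊔ A₁.toSubmodule, ∃ k : ℝ≥0, ∀ (q : ℝ≥0∞) (b : ℝ → ℝ) (E : Set ℝ),
      MeasurableSet E → E ⊆ Ioi 0 →
        weightedNorm q b E φ ≤ k * kNorm A₀ A₁ 0 q b E f ∧
        kNorm A₀ A₁ 0 q b E f ≤ k * weightedNorm q b E φ := by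
  obtain ⟨f, hf, k, -, hk⟩ := hs _ hφ.quasiConcave_toReal
  have hk : ∀ u ∈ Ioi (0 : ℝ), φ u ≤ k * K A₀ A₁ u f ∧ K A₀ A₁ u f ≤ k * φ u := fun u hu => by
    simpa only [ENNReal.ofReal_toReal (hφ.ne_top u hu), ENNReal.smul_def, smul_eq_mul]
      using hk u hu
  exact ⟨f, hf, k, fun q b E hE hE0 =>
    ⟨weightedNorm_le_mul ENNReal.coe_ne_top hE fun u hu => (hk u (hE0 hu)).1,
      weightedNorm_le_mul ENNReal.coe_ne_top hE fun u hu => (hk u (hE0 hu)).2⟩⟩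

theorem HolmstedtFormula.exists_weightedNorm_Ioo_le (hH : HolmstedtFormula A₀ A₁ q₀ q₁ b₀ b₁)
    (hq₀ : q₀ ≠ 0) (hq₁ : q₁ ≠ 0) (hb₀ : SVZero q₀ b₀) (hb₁ : SVZero q₁ b₁)
    (hs : KSurjective A₀ A₁) :
    ∃ k : ℝ≥0, ∀ φ, ExtQuasiConcave φ → ∀ t : Ioi (0 : ℝ),
      rho q₁ q₀ b₁ b₀ t * weightedNorm q₀ b₀ (Ioo 0 t) φ ≤ k * weightedNorm q₁ b₁ (Ioi 0) φ := by
  refine exists_uniform_le_mul_weightedNorm hq₁ hb₁.1 (fun t φ ψ C hC h => ?_) fun φ hφ hfin => ?_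
  · rw [mul_left_comm]
    gcongr
    exact mul_weightedNorm_le hC measurableSet_Ioo fun u hu => h u hu.1
  obtain ⟨f, hf, k, hk⟩ := hs.exists_kNorm_equiv hφ
  obtain ⟨c, hc⟩ := hH.exists_le_mul_interpK
  refine ⟨k * c * k, fun ⟨t, ht⟩ => ?_⟩
  have hnorm := (hk q₁ b₁ (Ioi 0) measurableSet_Ioi subset_rfl).2
  have hmem : f ∈ interpSpace A₀ A₁ 0 q₁ b₁ := ⟨hf, hnorm.trans_lt (by finiteness)⟩
  set ρ := rho q₀ q₁ b₀ b₁ t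
  rw [rho_swap hq₀ hq₁ hb₀.1 hb₁ ht]
  calc ρ⁻¹ * weightedNorm q₀ b₀ (Ioo 0 t) φ
      ≤ ρ⁻¹ * (k * kNorm A₀ A₁ 0 q₀ b₀ (Ioo 0 t) f) := by
        gcongr; exact (hk q₀ b₀ _ measurableSet_Ioo Ioo_subset_Ioi_self).1
    _ ≤ ρ⁻¹ * (k * (c * interpK A₀ A₁ q₀ q₁ b₀ b₁ ρ f)) := by
        gcongr; exact le_self_add.trans (hc f hf t ht)
    _ ≤ ρ⁻¹ * (k * (c * (ρ * (k * weightedNorm q₁ b₁ (Ioi 0) φ)))) := by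
        gcongr; exact (interpK_le_mul_interpNorm_right hmem ρ).trans (mul_le_mul_right hnorm _)
    _ = ρ⁻¹ * ρ * ((k * c * k : ℝ≥0) * weightedNorm q₁ b₁ (Ioi 0) φ) := by push_cast; ring
    _ = (k * c * k : ℝ≥0) * weightedNorm q₁ b₁ (Ioi 0) φ := by
        rw [ENNReal.inv_mul_cancel (rho_ne_zero hq₀ hq₁ hb₀.1 hb₁ ht)
          (rho_ne_top hq₀ hq₁ hb₀ hb₁.1 ht), one_mul]

theorem HolmstedtFormula.exists_rho_mul_weightedNorm_Ioi_le
    (hH : HolmstedtFormula A₀ A₁ q₀ q₁ b₀ b₁) (hq₀ : q₀ ≠ 0) (hb₀ : SlowlyVarying b₀)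
    (hs : KSurjective A₀ A₁) :
    ∃ k : ℝ≥0, ∀ φ, ExtQuasiConcave φ → ∀ t : Ioi (0 : ℝ),
      rho q₀ q₁ b₀ b₁ t * weightedNorm q₁ b₁ (Ioi t) φ ≤ k * weightedNorm q₀ b₀ (Ioi 0) φ := by
  refine exists_uniform_le_mul_weightedNorm hq₀ hb₀ (fun t φ ψ C hC h => ?_) fun φ hφ hfin => ?_
  · rw [mul_left_comm]
    gcongr
    exact mul_weightedNorm_le hC measurableSet_Ioi fun u hu =>
      h u (mem_Ioi.2 (lt_trans t.2 hu))
  obtain ⟨f, hf, k, hk⟩ := hs.exists_kNorm_equiv hφ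
  obtain ⟨c, hc⟩ := hH.exists_le_mul_interpK
  refine ⟨k * c * k, fun ⟨t, ht⟩ => ?_⟩
  have hnorm := (hk q₀ b₀ (Ioi 0) measurableSet_Ioi subset_rfl).2
  have hmem : f ∈ interpSpace A₀ A₁ 0 q₀ b₀ := ⟨hf, hnorm.trans_lt (by finiteness)⟩
  set ρ := rho q₀ q₁ b₀ b₁ t
  calc ρ * weightedNorm q₁ b₁ (Ioi t) φ
      ≤ ρ * (k * kNorm A₀ A₁ 0 q₁ b₁ (Ioi t) f) := by
        gcongr; exact (hk q₁ b₁ _ measurableSet_Ioi (Ioi_subset_Ioi (le_of_lt ht))).1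
    _ = k * (ρ * kNorm A₀ A₁ 0 q₁ b₁ (Ioi t) f) := mul_left_comm _ _ _
    _ ≤ k * (c * interpK A₀ A₁ q₀ q₁ b₀ b₁ ρ f) :=
        mul_le_mul_right (le_add_self.trans (hc f hf t ht)) _
    _ ≤ k * (c * (k * weightedNorm q₀ b₀ (Ioi 0) φ)) := by
        gcongr; exact (interpK_le_interpNorm_left hmem ρ).trans hnorm
    _ = (k * c * k : ℝ≥0) * weightedNorm q₀ b₀ (Ioi 0) φ := by push_cast; ring

theorem HolmstedtFormula.almostMonotoneOn_rho (hH : HolmstedtFormula A₀ A₁ q₀ q₁ b₀ b₁)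
    (hq₀ : q₀ ≠ 0) (hq₁ : q₁ ≠ 0) (hb₀ : SlowlyVarying b₀) (hb₁ : SVZero q₁ b₁)
    (hs : KSurjective A₀ A₁) : AlmostMonotoneOn (rho q₀ q₁ b₀ b₁) (Ioi 0) := by
  obtain ⟨k, hk⟩ := hH.exists_rho_mul_weightedNorm_Ioi_le hq₀ hb₀ hs
  obtain ⟨C, hC⟩ := hb₀.exists_weightedNorm_min_le hq₀
  refine ⟨k * C, fun s hs t ht hst => ?_⟩
  have ht0 : ENNReal.ofReal t ≠ 0 := (ENNReal.ofReal_pos.2 ht).ne'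
  have htail : tailNorm q₁ b₁ t ≤ weightedNorm q₁ b₁ (Ioi s)
      (fun u => min 1 (ENNReal.ofReal u / ENNReal.ofReal t)) := by
    refine le_trans ?_ (weightedNorm_mono_set (Ioi_subset_Ioi hst) _)
    rw [← one_mul (tailNorm q₁ b₁ t)]
    refine const_mul_tailNorm_le ENNReal.one_ne_top fun u hu => le_min le_rfl ?_
    rw [ENNReal.le_div_iff_mul_le (.inl ht0) (.inl ENNReal.ofReal_ne_top), one_mul]
    exact ENNReal.ofReal_le_ofReal (le_of_lt hu)
  rw [ENNReal.smul_def, smul_eq_mul]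
  refine (ENNReal.mul_le_mul_iff_left (hb₁.1.tailNorm_ne_zero hq₁ ht)
    (hb₁.tailNorm_ne_top hq₁ ht)).1 ?_
  calc rho q₀ q₁ b₀ b₁ s * tailNorm q₁ b₁ t
      ≤ rho q₀ q₁ b₀ b₁ s * weightedNorm q₁ b₁ (Ioi s)
          (fun u => min 1 (ENNReal.ofReal u / ENNReal.ofReal t)) := by gcongr
    _ ≤ k * (C * tailNorm q₀ b₀ t) :=
        (hk _ (extQuasiConcave_min t) ⟨s, hs⟩).trans (mul_le_mul_right (hC t ht) _)
    _ = (k * C : ℝ≥0) * rho q₀ q₁ b₀ b₁ t * tailNorm q₁ b₁ t := by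
        rw [mul_assoc, rho_mul_tailNorm hq₁ hb₁ ht]; push_cast; ring

end FromFormula

section Doubling

variable {R S : ℝ → ℝ≥0∞} {M N : ℝ≥0}

theorem two_pow_mul_le_of_doubling (hN : 1 ≤ N) (hS : ContinuousOn S (Ioi 0))
    (hR : ∀ s t, 0 < s → s ≤ t → R s ≤ M * R t)
    (hdouble : ∀ s t, 0 < s → s ≤ t → N * S t ≤ S s → 2 * R s ≤ R t) (k : ℕ) {s t : ℝ}
    (hs : 0 < s) (hst : s ≤ t) (h : N ^ k * S t ≤ S s) : 2 ^ k * R s ≤ M * R t := by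
  induction k generalizing s with
  | zero => simpa using hR s t hs hst
  | succ k ih =>
    have hN0 : (N : ℝ≥0∞) ≠ 0 := ENNReal.coe_ne_zero.2 (one_pos.trans_le hN).ne'
    have hN1 : (1 : ℝ≥0∞) ≤ N := by exact_mod_cast hN
    have hpow : N ^ k * S t ≤ S s / N := by
      rw [ENNReal.le_div_iff_mul_le (.inl hN0) (.inl ENNReal.coe_ne_top), mul_right_comm,
        ← pow_succ]
      exact h
    have hle : S t ≤ S s / N := (le_mul_of_one_le_left' (one_le_pow₀ hN1)).trans hpow
    have hge : S s / N ≤ S s := ENNReal.div_le_of_le_mul (le_mul_of_one_le_right' hN1)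
    obtain ⟨x, hx, hSx⟩ := intermediate_value_Icc' hst
      (hS.mono fun u hu => mem_Ioi.2 (hs.trans_le hu.1)) ⟨hle, hge⟩
    calc 2 ^ (k + 1) * R s = 2 ^ k * (2 * R s) := by ring
      _ ≤ 2 ^ k * R x := by
        gcongr
        exact hdouble s x hs hx.1 (by rw [hSx, ENNReal.mul_div_cancel hN0 ENNReal.coe_ne_top])
      _ ≤ M * R t := ih (hs.trans_le hx.1) hx.2 (hSx ▸ hpow)

theorem almostMonotoneOn_mul_rpow_logb_of_doubling (hN : 1 < N) (hS : ContinuousOn S (Ioi 0))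
    (hanti : AntitoneOn S (Ioi 0)) (h0 : ∀ t, 0 < t → S t ≠ 0) (htop : ∀ t, 0 < t → S t ≠ ∞)
    (hR : AlmostMonotoneOn R (Ioi 0))
    (hdouble : ∀ s t, 0 < s → s ≤ t → N * S t ≤ S s → 2 * R s ≤ R t) :
    AlmostMonotoneOn (fun t => R t * S t ^ Real.logb N 2) (Ioi 0) := by
  obtain ⟨M, hM⟩ := hR
  set δ := Real.logb N 2
  have hδ : 0 ≤ δ := (Real.logb_pos (by exact_mod_cast hN) one_lt_two).le
  have hNδ : (N : ℝ≥0∞) ^ δ = 2 := by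
    rw [← ENNReal.coe_rpow_of_nonneg _ hδ, ← ENNReal.coe_ofNat, ENNReal.coe_inj]
    exact NNReal.eq (Real.rpow_logb (by positivity) (by exact_mod_cast hN.ne') two_pos)
  refine ⟨2 * M, fun s hs t ht hst => ?_⟩
  obtain ⟨z, hz⟩ : ∃ z : ℝ≥0, (z : ℝ≥0∞) = S s / S t :=
    ⟨_, ENNReal.coe_toNNReal (ENNReal.div_ne_top (htop s hs) (h0 t ht))⟩
  have hSs : S s = z * S t := by rw [hz, ENNReal.div_mul_cancel (h0 t ht) (htop t ht)]
  have hz1 : 1 ≤ z := by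
    rw [← ENNReal.one_le_coe_iff, hz, ENNReal.le_div_iff_mul_le (.inl (h0 t ht))
      (.inl (htop t ht)), one_mul]
    exact hanti hs ht hst
  obtain ⟨k, hkz, hzk⟩ := exists_nat_pow_near hz1 hN
  have hRk : 2 ^ k * R s ≤ M * R t :=
    two_pow_mul_le_of_doubling hN.le hS
      (fun s t hs hst => hM s hs t (mem_Ioi.2 (hs.trans_le hst)) hst) hdouble k hs hst
      (by rw [hSs]; gcongr; exact_mod_cast hkz)
  have hSk : S s ^ δ ≤ 2 ^ (k + 1) * S t ^ δ :=
    calc S s ^ δ ≤ (N ^ (k + 1) * S t) ^ δ := by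
          rw [hSs]; gcongr; exact_mod_cast hzk.le
      _ = 2 ^ (k + 1) * S t ^ δ := by
          rw [ENNReal.mul_rpow_of_nonneg _ _ hδ, ← ENNReal.rpow_natCast, ← ENNReal.rpow_mul,
            mul_comm _ δ, ENNReal.rpow_mul, hNδ, ENNReal.rpow_natCast]
  rw [ENNReal.smul_def, smul_eq_mul]
  calc R s * S s ^ δ ≤ R s * (2 ^ (k + 1) * S t ^ δ) := by gcongr
    _ = 2 * (2 ^ k * R s) * S t ^ δ := by ring
    _ ≤ 2 * (M * R t) * S t ^ δ := by gcongr
    _ = (2 * M : ℝ≥0) * (R t * S t ^ δ) := by push_cast; ring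

theorem SVZero.continuousOn_tailNorm {q : ℝ≥0∞} {b : ℝ → ℝ} (hb : SVZero q b) (hq : q ≠ 0)
    (ht : q ≠ ∞) : ContinuousOn (tailNorm q b) (Ioi 0) := by
  intro t (h0 : 0 < t)
  have hmem : Ici (t / 2) ∈ 𝓝 t := Ici_mem_nhds (half_lt_self h0)
  have hcont := ENNReal.continuous_ofReal.comp_continuousOn
    (hb.continuousOn_toReal_tailNorm hq ht (half_pos h0))
  refine ((hcont.congr fun u hu => ?_).continuousAt hmem).continuousWithinAt
  exact (ENNReal.ofReal_toReal (hb.tailNorm_ne_top hq ((half_pos h0).trans_le hu))).symm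

theorem SVZero.exists_almostMonotoneOn_mul_tailNorm_rpow {p : ℝ≥0∞} {v : ℝ → ℝ}
    (hv : SVZero p v) (hp : p ≠ 0) (hpt : p ≠ ∞) (hR : AlmostMonotoneOn R (Ioi 0)) {X : ℝ}
    (hX : ∀ s t, 0 < s → s ≤ t → R t ≤ 2 * R s →
      Real.log ((tailNorm p v s).toReal / (tailNorm p v t).toReal) ≤ X) :
    ∃ δ : ℝ, 0 < δ ∧ δ < 1 ∧ AlmostMonotoneOn (fun t => R t * tailNorm p v t ^ δ) (Ioi 0) := by
  set N : ℝ≥0 := ⟨Real.exp X + 2, by positivity⟩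
  have hN : (N : ℝ) = Real.exp X + 2 := rfl
  have hN2 : (2 : ℝ) < N := by rw [hN]; linarith [Real.exp_pos X]
  have hN1 : (1 : ℝ) < N := by linarith
  refine ⟨Real.logb N 2, Real.logb_pos hN1 one_lt_two, ?_,
    almostMonotoneOn_mul_rpow_logb_of_doubling hN1 (hv.continuousOn_tailNorm hp hpt)
      (tailNorm_antitone.antitoneOn _) (fun t ht => hv.1.tailNorm_ne_zero hp ht)
      (fun t ht => hv.tailNorm_ne_top hp ht) hR fun s t hs hst hdrop => ?_⟩
  · rwa [Real.logb_lt_iff_lt_rpow hN1 two_pos, Real.rpow_one]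
  · by_contra! hlt
    have hTt := hv.toReal_tailNorm_pos hp (hs.trans_le hst)
    have hTs := hv.toReal_tailNorm_pos hp hs
    have hdrop : N * (tailNorm p v t).toReal ≤ (tailNorm p v s).toReal := by
      simpa only [ENNReal.toReal_mul, ENNReal.coe_toReal]
        using ENNReal.toReal_mono (hv.tailNorm_ne_top hp hs) hdrop
    have hlog := hX s t hs hst hlt.le
    rw [Real.log_le_iff_le_exp (by positivity), div_le_iff₀ hTt] at hlog
    nlinarith

end Doubling

section Converse

variable {𝕜 V : Type*} [RCLike 𝕜] [AddCommGroup V] [Module 𝕜 V] [TopologicalSpace V]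
  {A₀ A₁ : QuasiNormedSubspace 𝕜 V} {q₀ q₁ : ℝ≥0∞} {b₀ b₁ : ℝ → ℝ}

theorem HolmstedtFormula.exists_log_tailNorm_left_le (hH : HolmstedtFormula A₀ A₁ q₀ q₁ b₀ b₁)
    (hq₀ : q₀ ≠ 0) (hq : q₀ < q₁) (hb₀ : SVZero q₀ b₀) (hb₁ : SVZero q₁ b₁)
    (hs : KSurjective A₀ A₁) :
    ∃ X : ℝ, ∀ s t, 0 < s → s ≤ t → rho q₀ q₁ b₀ b₁ t ≤ 2 * rho q₀ q₁ b₀ b₁ s →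
      Real.log ((tailNorm q₀ b₀ s).toReal / (tailNorm q₀ b₀ t).toReal) ≤ X := by
  have hq₁ : q₁ ≠ 0 := (zero_le.trans_lt hq).ne'
  obtain ⟨A, hA⟩ :=
    (hH.almostMonotoneOn_rho hq₀ hq₁ hb₀.1 hb₁ hs).exists_le_mul_of_le_two_mul ordConnected_Ioi
  obtain ⟨k, hk⟩ := hH.exists_weightedNorm_Ioo_le hq₀ hq₁ hb₀ hb₁ hs
  obtain ⟨X, hX⟩ := exists_log_tailNorm_div_le_of_hardy hq hq₀ hb₀ hb₁ A k
  refine ⟨X, fun s t h0 hst hle => ?_⟩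
  have ht := h0.trans_le hst
  have hρ := fun u (hu : u ∈ Icc s t) => rho_ne_zero hq₀ hq₁ hb₀.1 hb₁ (h0.trans_le hu.1)
  have hρ' := fun u (hu : u ∈ Icc s t) => rho_ne_top hq₀ hq₁ hb₀ hb₁.1 (h0.trans_le hu.1)
  refine hX s t t h0 ⟨hst, le_rfl⟩ (fun u hu u' hu' => ?_) fun φ hφ => ?_
  · rw [rho_swap hq₀ hq₁ hb₀.1 hb₁ (h0.trans_le hu.1),
      rho_swap hq₀ hq₁ hb₀.1 hb₁ (h0.trans_le hu'.1)]
    exact inv_le_mul_inv_of_le_mul (hρ u' hu') (hρ' u' hu') (hρ u hu) (hρ' u hu)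
      (hA s h0 t ht hle u' hu' u hu)
  · refine le_trans ?_ (hk φ hφ ⟨t, ht⟩)
    rw [weightedNorm_Ioo_eq_Ioc]
    exact mul_le_mul_right (weightedNorm_mono_set (Ioc_subset_Ioc_left h0.le) φ) _

theorem HolmstedtFormula.exists_log_tailNorm_right_le (hH : HolmstedtFormula A₀ A₁ q₀ q₁ b₀ b₁)
    (hq₁ : q₁ ≠ 0) (hq : q₁ < q₀) (hb₀ : SVZero q₀ b₀) (hb₁ : SVZero q₁ b₁)
    (hs : KSurjective A₀ A₁) :
    ∃ X : ℝ, ∀ s t, 0 < s → s ≤ t → rho q₀ q₁ b₀ b₁ t ≤ 2 * rho q₀ q₁ b₀ b₁ s →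
      Real.log ((tailNorm q₁ b₁ s).toReal / (tailNorm q₁ b₁ t).toReal) ≤ X := by
  have hq₀ : q₀ ≠ 0 := (zero_le.trans_lt hq).ne'
  obtain ⟨A, hA⟩ :=
    (hH.almostMonotoneOn_rho hq₀ hq₁ hb₀.1 hb₁ hs).exists_le_mul_of_le_two_mul ordConnected_Ioi
  obtain ⟨k, hk⟩ := hH.exists_rho_mul_weightedNorm_Ioi_le hq₀ hb₀.1 hs
  obtain ⟨X, hX⟩ := exists_log_tailNorm_div_le_of_hardy hq hq₁ hb₁ hb₀ A k
  refine ⟨X, fun s t h0 hst hle => ?_⟩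
  refine hX s s t h0 ⟨le_rfl, hst⟩ (hA s h0 t (mem_Ioi.2 (h0.trans_le hst)) hle) fun φ hφ => ?_
  exact (mul_le_mul_right (weightedNorm_mono_set Ioc_subset_Ioi_self φ) _).trans (hk φ hφ ⟨s, h0⟩)

theorem RhoCondition.of_almostMonotoneOn_rho_mul_tailNorm_right_rpow (hq₀ : q₀ ≠ 0)
    (hq₁ : q₁ ≠ 0) (hb₀ : SVZero q₀ b₀) (hb₁ : SVZero q₁ b₁) {δ : ℝ} (hδ0 : 0 < δ) (hδ1 : δ < 1)
    (h : AlmostMonotoneOn (fun t => rho q₀ q₁ b₀ b₁ t * tailNorm q₁ b₁ t ^ δ) (Ioi 0)) :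
    RhoCondition q₀ q₁ b₀ b₁ := by
  have hδ' : 0 < 1 - δ := sub_pos.2 hδ1
  set ε : ℝ := (1 - δ)⁻¹ - 1
  have hε : 0 < ε := sub_pos.2 ((one_lt_inv₀ hδ').2 (by linarith))
  have hεδ : (1 + ε)⁻¹ = 1 - δ := by rw [add_sub_cancel, inv_inv]
  refine .of_almostMonotoneOn hq₀ hq₁ hb₀ hb₁.1 hε
    ((h.rpow (p := 1 + ε) (by linarith)).congr fun t ht => ?_)
  calc (rho q₀ q₁ b₀ b₁ t * tailNorm q₁ b₁ t ^ δ) ^ (1 + ε)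
      = (rhoEps ε q₀ q₁ b₀ b₁ t ^ (1 + ε)⁻¹) ^ (1 + ε) := by
        rw [rhoEps_rpow_inv hq₁ hb₁ (by linarith) ht, hεδ, sub_sub_cancel]
    _ = rhoEps ε q₀ q₁ b₀ b₁ t := ENNReal.rpow_inv_rpow (by linarith) _

theorem HolmstedtFormula.rhoCondition (hH : HolmstedtFormula A₀ A₁ q₀ q₁ b₀ b₁) (hq₀ : q₀ ≠ 0)
    (hq₁ : q₁ ≠ 0) (hq : q₀ ≠ q₁) (hb₀ : SVZero q₀ b₀) (hb₁ : SVZero q₁ b₁)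
    (hs : KSurjective A₀ A₁) : RhoCondition q₀ q₁ b₀ b₁ := by
  have hρ := hH.almostMonotoneOn_rho hq₀ hq₁ hb₀.1 hb₁ hs
  rcases hq.lt_or_gt with hlt | hlt
  · obtain ⟨X, hX⟩ := hH.exists_log_tailNorm_left_le hq₀ hlt hb₀ hb₁ hs
    obtain ⟨δ, hδ, -, hmono⟩ :=
      hb₀.exists_almostMonotoneOn_mul_tailNorm_rpow hq₀ hlt.ne_top hρ hX
    exact .of_almostMonotoneOn hq₀ hq₁ hb₀ hb₁.1 hδ
      (hmono.congr fun t ht => (rhoEps_eq_rho_mul hq₀ hb₀ δ ht).symm)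
  · obtain ⟨X, hX⟩ := hH.exists_log_tailNorm_right_le hq₁ hlt hb₀ hb₁ hs
    obtain ⟨δ, hδ0, hδ1, hmono⟩ :=
      hb₁.exists_almostMonotoneOn_mul_tailNorm_rpow hq₁ hlt.ne_top hρ hX
    exact .of_almostMonotoneOn_rho_mul_tailNorm_right_rpow hq₀ hq₁ hb₀ hb₁ hδ0 hδ1 hmono

end Converse

end Holmstedt

end

theorem mainTheorem1 {𝕜 V : Type*} [RCLike 𝕜] [AddCommGroup V] [Module 𝕜 V]
    [TopologicalSpace V] [IsTopologicalAddGroup V] [ContinuousSMul 𝕜 V] [T2Space V]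
    (A₀ A₁ : Holmstedt.QuasiNormedSubspace 𝕜 V)
    (q₀ q₁ : ℝ≥0∞) (hq₀ : 0 < q₀) (hq₁ : 0 < q₁) (hq : q₀ ≠ q₁)
    (b₀ b₁ : ℝ → ℝ) (hb₀ : Holmstedt.SVZero q₀ b₀) (hb₁ : Holmstedt.SVZero q₁ b₁) :
    (Holmstedt.RhoCondition q₀ q₁ b₀ b₁ → Holmstedt.HolmstedtFormula A₀ A₁ q₀ q₁ b₀ b₁) ∧
    (Holmstedt.KSurjective A₀ A₁ → Holmstedt.HolmstedtFormula A₀ A₁ q₀ q₁ b₀ b₁ →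
      Holmstedt.RhoCondition q₀ q₁ b₀ b₁) :=
  ⟨fun h => h.holmstedtFormula A₀ A₁ hq₀.ne' hq₁.ne' hb₀ hb₁,
    fun hs hH => hH.rhoCondition hq₀.ne' hq₁.ne' hq hb₀ hb₁ hs⟩
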